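/- Let $H:[0,\infty)\to[0,1]$ be non-increasing with unbounded support, i.e. $\int_r^\infty H(x)\,dx>0$ for all $r\ge 0$, let $\gamma>0$, and for $L>1$ put $R_L=\gamma\ln L$. For each $L>1$ consider the soft random geometric graph on $\mathbb{R}$ whose nodes are the points of a Poisson process $\Phi$ of unit intensity on $\mathbb{R}$ and in which, given $\Phi$, each pair of nodes $x,y\in\Phi$ is joined by an edge with probability $H(|x-y|/R_L)$, independently over pairs. A node $x\in\Phi$ marks an uncrossed gap if there is no edge between $\Phi\cap(-\infty,x]$ and $\Phi\cap(x,\infty)$. Let $N_{\mathrm{ucg}}$ be the number of uncrossed gaps marked by nodes in $[0,L]$. Let $\mathbb{E}_0$ denote expectation under the Palm measure (conditioning on a node at the origin), given for an event $A$ by $$\mathbb{P}_0(A)=\frac{\mathbb{E}\,\#\{x\in\Phi\cap[0,1]:\ \text{the graph translated by } -x \text{ belongs to } A\}}{\mathbb{E}\,\#(\Phi\cap[0,1])},$$ and let $X_0$ be the indicator that the origin is a node that marks an uncrossed gap. Then: 1. $\mathbb{E}[N_{\mathrm{ucg}}]=L\,\mathbb{E}_0[X_0]$ for every $L>1$; 2.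 for every $\kappa>0$, $\mathbb{E}_0[X_0]=O(L^{-\kappa})$ as $L\to\infty$; 3. for every $\kappa>0$, $\mathbb{E}[N_{\mathrm{ucg}}]\le L^{1-\kappa}(1+o(1))$ as $L\to\infty$; 4. $\mathbb{E}[N_{\mathrm{ucg}}]\to 0$ and $\mathbb{P}(\text{there is an uncrossed gap in }[0,L])\to 0$ as $L\to\infty$. Here $\gamma>0$ is arbitrary; in particular, if $H$ is integrable, this holds at the isolated-node threshold $\gamma=1/(2\int_0^\infty H(x)\,dx)$. -/

import Mathlib

open MeasureTheory ProbabilityTheory Filter Topology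
open scoped ENNReal

namespace SoftRGG

/-- A countably infinite graph drawn on the real line: the nodes are numbered by `ℕ`
(in no particular order), node `i` sits at `pos i`, and `graph` is the edge relation. -/
structure SpatialGraph where
  pos : ℕ → ℝ
  graph : SimpleGraph ℕ

/-- The set of node locations. -/
def SpatialGraph.points (g : SpatialGraph) : Set ℝ := Set.range g.pos

/-- The graph seen from `x`: every node is translated by `-x`, the edges are kept. -/
def SpatialGraph.shift (g : SpatialGraph) (x : ℝ) : SpatialGraph where
  pos := fun i => g.pos i - x
  graph := g.graph

/-- The point `x` is a node and marks an uncrossed gap: there is no edge between a node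
in `(-∞, x]` and a node in `(x, ∞)`. -/
def SpatialGraph.UncrossedGapAt (g : SpatialGraph) (x : ℝ) : Prop :=
  x ∈ g.points ∧ ∀ i j : ℕ, g.pos i ≤ x → x < g.pos j → ¬ g.graph.Adj i j

/-- The number of uncrossed gaps in `[0, L]`. -/
noncomputable def SpatialGraph.numUncrossedGaps (g : SpatialGraph) (L : ℝ) : ℕ∞ :=
  {x : ℝ | x ∈ Set.Icc 0 L ∧ g.UncrossedGapAt x}.encard

/-- The random points `X 0, X 1, …` are (an enumeration of) a Poisson point process on `ℝ`
of unit intensity: they are almost surely distinct, the number of points in a Borel set `B` of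
finite length is Poisson with mean the length of `B`, and the numbers of points in finitely
many pairwise disjoint Borel sets are independent. -/
structure IsUnitPoissonProcess {Ω : Type*} [MeasurableSpace Ω] (μ : Measure Ω)
    (X : Ω → ℕ → ℝ) : Prop where
  measurable : Measurable X
  injective : ∀ᵐ ω ∂μ, Function.Injective (X ω)
  poisson : ∀ B : Set ℝ, MeasurableSet B → volume B ≠ ∞ → ∀ n : ℕ,
    μ {ω | (Set.range (X ω) ∩ B).encard = n} = poissonMeasure (volume B).toNNReal {n}
  indep : ∀ (m : ℕ) (B : Fin m → Set ℝ), (∀ k, MeasurableSet (B k)) →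
    Pairwise (fun k l => Disjoint (B k) (B l)) →
    iIndepFun (fun (k : Fin m) (ω : Ω) => (Set.range (X ω) ∩ B k).encard) μ

/-- `g` is a soft random geometric graph on `ℝ` with connection function `H`: its nodes form a
Poisson process of unit intensity and, conditionally on all node locations, distinct pairs of
nodes are joined independently of each other, a pair at distance `r` with probability `H r`. -/
structure IsSoftRGG {Ω : Type*} [MeasurableSpace Ω] (μ : Measure Ω)
    (H : ℝ → ℝ) (g : Ω → SpatialGraph) : Prop where
  nodes : IsUnitPoissonProcess μ (fun ω => (g ω).pos)
  measurableSet_adj : ∀ i j : ℕ, MeasurableSet {ω | (g ω).graph.Adj i j}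
  edges : ∀ S : Finset (ℕ × ℕ), (∀ e ∈ S, e.1 < e.2) →
    μ⟦{ω | ∀ e ∈ S, (g ω).graph.Adj e.1 e.2} |
        MeasurableSpace.comap (fun ω => (g ω).pos) MeasurableSpace.pi⟧
      =ᵐ[μ] fun ω => ∏ e ∈ S, H |(g ω).pos e.1 - (g ω).pos e.2|

/-- The Palm probability `ℙ₀(E)` of an event `E`, for a random graph on `ℝ` with stationary law:
the expected number of nodes in `[0, 1]` from which the graph is seen to lie in `E`, divided by
the expected number of nodes in `[0, 1]`. -/
noncomputable def palmProb {Ω : Type*} [MeasurableSpace Ω] (μ : Measure Ω)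
    (g : Ω → SpatialGraph) (E : Set SpatialGraph) : ℝ≥0∞ :=
  (∫⁻ ω, (({x : ℝ | x ∈ (g ω).points ∩ Set.Icc 0 1 ∧ (g ω).shift x ∈ E}.encard : ℕ∞) : ℝ≥0∞) ∂μ) /
    (∫⁻ ω, ((((g ω).points ∩ Set.Icc 0 1).encard : ℕ∞) : ℝ≥0∞) ∂μ)

/-- `𝔼₀[X₀]`: the Palm probability that the node at the origin marks an uncrossed gap. -/
noncomputable def palmUncrossed {Ω : Type*} [MeasurableSpace Ω] (μ : Measure Ω)
    (g : Ω → SpatialGraph) : ℝ≥0∞ :=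
  palmProb μ g {c | c.UncrossedGapAt 0}

/-- `𝔼[N_ucg]`: the expected number of uncrossed gaps in `[0, L]`. -/
noncomputable def expectedUncrossedGaps {Ω : Type*} [MeasurableSpace Ω] (μ : Measure Ω)
    (g : Ω → SpatialGraph) (L : ℝ) : ℝ≥0∞ :=
  ∫⁻ ω, (((g ω).numUncrossedGaps L : ℕ∞) : ℝ≥0∞) ∂μ

end SoftRGG

/-! Given the nodes, a node at `y` is uncrossed with probability `∏ (1 - H)` over the pairs
straddling `y`, which is written `exp (-crossCost)`. For `y` in `[0, 1]`, keep only the pairs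
joining `[-l, 0)` to `(1, 1 + l]`. If these windows hold `a` and `b` nodes and each such pair is
joined with probability at least `h`, the gap probability is at most `exp (-h a b)`, and this is at
most `exp (-b) + exp (1/h) exp (-a)`: a gap forces one window to be sparse. Take `l = K R_L`. By
unbounded support, `h = H (2K + 1)` is a positive constant free of `L`, whereas `a` and `b` are
Poisson of mean `K γ log L`. The expectation is therefore of order `L ^ (-K γ (1 - 1/e))`, and `K`
is arbitrary (`gapIntensity_unit_le`, `palmUncrossed_decay`).

The identity with the Palm probability says that the intensity measure of the gaps is a multiple of
Lebesgue measure (`gapIntensity_Icc`). Once the edges are integrated out (`measure_gapSet`), this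
intensity is the mean of a functional of the counting measure of the nodes alone. The law of that
counting measure is fixed by the Poisson axioms (`map_pointMeasure_unique`), which translation
preserves. So the intensity is translation invariant, and uniqueness of Haar measure applies. -/

namespace SoftRGG

/-! ### Counting measures of point sequences. -/

/-- The counting measure of a sequence of points. -/
noncomputable def pointMeasure (x : ℕ → ℝ) : Measure ℝ := Measure.sum fun i => Measure.dirac (x i)

lemma lintegral_pointMeasure (x : ℕ → ℝ) (f : ℝ → ℝ≥0∞) :
    ∫⁻ y, f y ∂pointMeasure x = ∑' i, f (x i) := by
  simp [pointMeasure, lintegral_sum_measure]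

lemma pointMeasure_apply (x : ℕ → ℝ) {B : Set ℝ} (hB : MeasurableSet B) :
    pointMeasure x B = ∑' i, B.indicator 1 (x i) := by
  simp [pointMeasure, hB]

lemma measurable_pointMeasure : Measurable pointMeasure := by
  refine Measure.measurable_of_measurable_coe _ fun B hB => ?_
  simp_rw [pointMeasure_apply _ hB]
  refine Measurable.tsum fun i => ?_
  exact (measurable_one.indicator hB).comp (measurable_pi_apply i)

/-- Injectivity excludes multiplicities, so summing over indices counts distinct locations. -/
lemma tsum_ite_eq_encard {x : ℕ → ℝ} (hx : Function.Injective x) (p : ℝ → Prop) [DecidablePred p] :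
    ∑' i, (if p (x i) then (1 : ℝ≥0∞) else 0)
      = (({y | y ∈ Set.range x ∧ p y}.encard : ℕ∞) : ℝ≥0∞) := by
  have h : {y | y ∈ Set.range x ∧ p y} = x '' {i | p (x i)} := by
    ext y
    constructor
    · rintro ⟨⟨i, rfl⟩, hi⟩
      exact ⟨i, hi, rfl⟩
    · rintro ⟨i, hi, rfl⟩
      exact ⟨⟨i, rfl⟩, hi⟩
  rw [h, hx.encard_image, ← ENNReal.tsum_set_one,
    tsum_subtype {i | p (x i)} (fun _ => (1 : ℝ≥0∞))]
  simp [Set.indicator_apply]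

lemma pointMeasure_eq_encard {x : ℕ → ℝ} (hx : Function.Injective x) {B : Set ℝ}
    (hB : MeasurableSet B) :
    pointMeasure x B = (((Set.range x ∩ B).encard : ℕ∞) : ℝ≥0∞) := by
  classical
  rw [pointMeasure_apply x hB]
  exact tsum_ite_eq_encard hx (· ∈ B)

lemma lintegral_pointMeasure_sub (x : ℕ → ℝ) (t : ℝ) (f : ℝ → ℝ≥0∞) :
    ∫⁻ y, f y ∂pointMeasure (fun i => x i - t) = ∫⁻ y, f (y - t) ∂pointMeasure x := by
  simp [lintegral_pointMeasure]

/-! ### Poisson counts: law, Laplace transform, mean, translation. -/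

section Poisson

variable {Ω : Type*} [MeasurableSpace Ω] {μ : Measure Ω} {X : Ω → ℕ → ℝ}

lemma IsUnitPoissonProcess.measurable_count (hX : IsUnitPoissonProcess μ X) {B : Set ℝ}
    (hB : MeasurableSet B) : Measurable fun ω => pointMeasure (X ω) B :=
  (Measure.measurable_coe hB).comp (measurable_pointMeasure.comp hX.measurable)

lemma IsUnitPoissonProcess.count_ae_eq (hX : IsUnitPoissonProcess μ X) {B : Set ℝ}
    (hB : MeasurableSet B) :
    (fun ω => (((Set.range (X ω) ∩ B).encard : ℕ∞) : ℝ≥0∞)) =ᵐ[μ]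
      fun ω => pointMeasure (X ω) B := by
  filter_upwards [hX.injective] with ω hω
  rw [pointMeasure_eq_encard hω hB]

lemma IsUnitPoissonProcess.iIndepFun_count (hX : IsUnitPoissonProcess μ X)
    {ι : Type*} [Fintype ι] (B : ι → Set ℝ) (hB : ∀ k, MeasurableSet (B k))
    (hd : Pairwise (fun k l => Disjoint (B k) (B l))) :
    iIndepFun (fun (k : ι) (ω : Ω) => pointMeasure (X ω) (B k)) μ := by
  let e := Fintype.equivFin ι
  have h := hX.indep _ (fun k => B (e.symm k)) (fun k => hB _)
    (fun k l hkl => hd (e.symm.injective.ne hkl))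
  have h2 := (h.comp (fun _ => fun n : ℕ∞ => (n : ℝ≥0∞)) (fun _ => Measurable.of_discrete))
  have h3 := h2.precomp (g := e) e.injective
  refine h3.congr fun i => ?_
  have := hX.count_ae_eq (hB i)
  simpa [Function.comp_def] using this

lemma IsUnitPoissonProcess.map_count [IsProbabilityMeasure μ] (hX : IsUnitPoissonProcess μ X)
    {B : Set ℝ} (hB : MeasurableSet B) (hv : volume B ≠ ∞) :
    μ.map (fun ω => pointMeasure (X ω) B)
      = (poissonMeasure (volume B).toNNReal).map (Nat.cast : ℕ → ℝ≥0∞) := by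
  have hm := hX.measurable_count hB
  have : IsProbabilityMeasure (μ.map (fun ω => pointMeasure (X ω) B)) :=
    Measure.isProbabilityMeasure_map hm.aemeasurable
  have : IsProbabilityMeasure
      ((poissonMeasure (volume B).toNNReal).map (Nat.cast : ℕ → ℝ≥0∞)) :=
    Measure.isProbabilityMeasure_map Measurable.of_discrete.aemeasurable
  -- Only the probabilities of finite counts are given. They yield one inequality, and equality
  -- follows because both sides have total mass one.
  refine (Measure.eq_of_le_of_measure_univ_eq (Measure.le_iff.2 fun s hs => ?_) (by simp)).symm
  rw [Measure.map_apply Measurable.of_discrete hs, Measure.map_apply hm hs]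
  set S : Set ℕ := Nat.cast ⁻¹' s
  have h1 : poissonMeasure (volume B).toNNReal S
      = ∑' n : S, μ {ω | pointMeasure (X ω) B = (n : ℕ)} := by
    nth_rewrite 1 [← Set.biUnion_of_singleton S]
    rw [measure_biUnion S.to_countable
      (fun i _ j _ hij => by simpa [Function.onFun] using hij) (fun i _ => MeasurableSet.of_discrete)]
    refine tsum_congr fun n => ?_
    rw [← hX.poisson B hB hv n]
    refine measure_congr ?_
    filter_upwards [hX.count_ae_eq hB] with ω hω
    rw [eq_iff_iff]
    change (Set.range (X ω) ∩ B).encard = (n : ℕ) ↔ pointMeasure (X ω) B = (n : ℕ)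
    rw [← hω]
    norm_cast
  rw [h1, ← measure_biUnion (f := fun n : ℕ => {ω | pointMeasure (X ω) B = n}) S.to_countable]
  · refine measure_mono fun ω hω => ?_
    simp only [Set.mem_iUnion, Set.mem_ofPred_eq] at hω
    obtain ⟨n, hn, h⟩ := hω
    rw [Set.mem_preimage, h]
    exact hn
  · intro i _ j _ hij
    refine Set.disjoint_left.2 fun ω h h' => hij ?_
    have : ((i : ℕ) : ℝ≥0∞) = j := h.symm.trans h'
    exact_mod_cast this
  · exact fun n _ => hm (measurableSet_singleton _)

lemma IsUnitPoissonProcess.lintegral_count [IsProbabilityMeasure μ]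
    (hX : IsUnitPoissonProcess μ X) {B : Set ℝ} (hB : MeasurableSet B) (hv : volume B ≠ ∞)
    {f : ℝ≥0∞ → ℝ≥0∞} (hf : Measurable f) :
    ∫⁻ ω, f (pointMeasure (X ω) B) ∂μ
      = ∫⁻ n, f (n : ℕ) ∂poissonMeasure (volume B).toNNReal := by
  rw [← lintegral_map hf (hX.measurable_count hB), hX.map_count hB hv,
    lintegral_map hf Measurable.of_discrete]

lemma IsUnitPoissonProcess.ae_count_lt_top [IsProbabilityMeasure μ]
    (hX : IsUnitPoissonProcess μ X) {B : Set ℝ} (hB : MeasurableSet B) (hv : volume B ≠ ∞) :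
    ∀ᵐ ω ∂μ, pointMeasure (X ω) B < ∞ := by
  have h : ∀ᵐ y ∂μ.map (fun ω => pointMeasure (X ω) B), y < ∞ := by
    rw [hX.map_count hB hv, ae_map_iff Measurable.of_discrete.aemeasurable measurableSet_Iio]
    simp
  exact ae_of_ae_map (hX.measurable_count hB).aemeasurable h

lemma lintegral_poissonMeasure (r : NNReal) (f : ℕ → ℝ≥0∞) :
    ∫⁻ n, f n ∂poissonMeasure r
      = ∑' n : ℕ, ENNReal.ofReal (Real.exp (-r) * r ^ n / n.factorial) * f n := by
  simp [poissonMeasure, lintegral_sum_measure]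

lemma lintegral_exp_neg_poissonMeasure (r : NNReal) :
    ∫⁻ n, ENNReal.ofReal (Real.exp (-(n : ℕ))) ∂poissonMeasure r
      = ENNReal.ofReal (Real.exp (-(r * (1 - Real.exp (-1))))) := by
  rw [lintegral_poissonMeasure]
  have h : HasSum (fun n : ℕ => Real.exp (-r) * r ^ n / n.factorial * Real.exp (-(n : ℕ)))
      (Real.exp (-(r * (1 - Real.exp (-1))))) := by
    have h1 := (NormedSpace.expSeries_div_hasSum_exp (r * Real.exp (-1) : ℝ)).mul_left
      (Real.exp (-r))
    rw [← Real.exp_eq_exp_ℝ, ← Real.exp_add] at h1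
    have h2 : ∀ n : ℕ, Real.exp (-r) * r ^ n / n.factorial * Real.exp (-(n : ℕ))
        = Real.exp (-r) * ((r * Real.exp (-1)) ^ n / n.factorial) := by
      intro n
      rw [mul_pow, ← Real.exp_nat_mul, mul_neg_one]
      ring
    have h3 : -((r : ℝ) * (1 - Real.exp (-1))) = -r + r * Real.exp (-1) := by ring
    simp_rw [h2, h3]
    exact h1
  simp_rw [← ENNReal.ofReal_mul' (Real.exp_nonneg _)]
  rw [← ENNReal.ofReal_tsum_of_nonneg (fun n => by positivity) h.summable, h.tsum_eq]

lemma lintegral_id_poissonMeasure (r : NNReal) :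
    ∫⁻ n, ((n : ℕ) : ℝ≥0∞) ∂poissonMeasure r = r := by
  rw [lintegral_poissonMeasure, tsum_eq_zero_add' ENNReal.summable]
  have h : ∀ n : ℕ, ENNReal.ofReal (Real.exp (-r) * r ^ (n + 1) / (n + 1).factorial)
      * ((n + 1 : ℕ) : ℝ≥0∞)
      = ENNReal.ofReal (Real.exp (-r) * r ^ n / n.factorial) * r := by
    intro n
    rw [← ENNReal.ofReal_natCast, ← ENNReal.ofReal_mul (by positivity),
      ← ENNReal.ofReal_coe_nnreal, ← ENNReal.ofReal_mul (by positivity)]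
    congr 1
    push_cast [Nat.factorial_succ]
    field_simp
    ring
  simp_rw [h]
  rw [ENNReal.tsum_mul_right]
  have := lintegral_poissonMeasure r 1
  simp only [Pi.one_apply, mul_one, lintegral_const, measure_univ] at this
  rw [← this]
  simp

lemma IsUnitPoissonProcess.lintegral_count_id [IsProbabilityMeasure μ]
    (hX : IsUnitPoissonProcess μ X) {B : Set ℝ} (hB : MeasurableSet B) (hv : volume B ≠ ∞) :
    ∫⁻ ω, pointMeasure (X ω) B ∂μ = volume B := by
  rw [hX.lintegral_count (f := fun y => y) hB hv measurable_id,
    lintegral_id_poissonMeasure, ENNReal.coe_toNNReal hv]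

lemma IsUnitPoissonProcess.sub_const (hX : IsUnitPoissonProcess μ X) (t : ℝ) :
    IsUnitPoissonProcess μ (fun ω i => X ω i - t) := by
  have hr : ∀ (ω : Ω) (B : Set ℝ), (Set.range (fun i => X ω i - t) ∩ B).encard
      = (Set.range (X ω) ∩ (fun y => y - t) ⁻¹' B).encard := by
    intro ω B
    rw [← (sub_left_injective (b := t)).encard_image (Set.range (X ω) ∩ _),
      Set.image_inter_preimage, ← Set.range_comp]
    rfl
  have hm : Measurable fun y : ℝ => y - t := measurable_id.sub_const t
  refine ⟨?_, ?_, ?_, ?_⟩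
  · exact measurable_pi_lambda _ fun i =>
      ((measurable_pi_apply i).comp hX.measurable).sub_const t
  · filter_upwards [hX.injective] with ω hω i j hij
    exact hω (sub_left_injective hij)
  · intro B hB hv n
    have hvol : volume ((fun y => y - t) ⁻¹' B) = volume B :=
      by simp [sub_eq_add_neg, measure_preimage_add_right]
    simp_rw [hr]
    rw [hX.poisson _ (hm hB) (by rwa [hvol]), hvol]
  · intro m B hB hd
    simp_rw [hr]
    exact hX.indep m _ (fun k => hm (hB k)) fun k l hkl => (hd hkl).preimage _

end Poisson

/-! ### Uniqueness of the law of the Poisson counting measure. -/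

/-- A probability law on measures on `ℝ` is determined by the joint laws of the masses of
disjoint sets of finite length. -/
theorem ext_of_map_disjoint {P Q : Measure (Measure ℝ)} [IsProbabilityMeasure P]
    [IsProbabilityMeasure Q]
    (h : ∀ (ι : Type) [Fintype ι] (B : ι → Set ℝ), (∀ i, MeasurableSet (B i)) →
      (∀ i, volume (B i) ≠ ∞) → Pairwise (fun k l => Disjoint (B k) (B l)) →
      P.map (fun ξ i => ξ (B i)) = Q.map (fun ξ i => ξ (B i))) : P = Q := by
  classical
  let I : Type := {B : Set ℝ // MeasurableSet B ∧ volume B ≠ ∞}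
  let Φ : Measure ℝ → I → ℝ≥0∞ := fun ξ b => ξ b.1
  have hΦ : Measurable Φ := measurable_pi_lambda _ fun b => Measure.measurable_coe b.2.1
  have key : P.map Φ = Q.map Φ := by
    have : IsProbabilityMeasure (Q.map Φ) := Measure.isProbabilityMeasure_map hΦ.aemeasurable
    -- The finite-dimensional marginals determine the law of the whole family of masses.
    refine IsProjectiveLimit.unique (P := fun J => (Q.map Φ).map J.restrict) (fun J => ?_)
      (fun J => rfl)
    have hJ : Measurable (J.restrict : (I → ℝ≥0∞) → (J → ℝ≥0∞)) :=
      measurable_pi_lambda _ fun _ => measurable_pi_apply _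
    change (P.map Φ).map J.restrict = (Q.map Φ).map J.restrict
    rw [Measure.map_map hJ hΦ, Measure.map_map hJ hΦ]
    -- Overlapping sets are cut into the atoms of the finite algebra they generate. The empty `T` is
    -- left out: its atom is the common complement, of infinite length, and lies in none of the
    -- sets.
    let ι : Type := {T : Finset J // T.Nonempty}
    let atom : ι → Set ℝ := fun T => {x | ∀ b : J, x ∈ b.1.1 ↔ b ∈ T.1}
    have hatom_meas : ∀ T, MeasurableSet (atom T) := by
      intro T
      have : atom T = ⋂ b : J, {x | x ∈ b.1.1 ↔ b ∈ T.1} := by ext x; simp [atom]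
      rw [this]
      refine MeasurableSet.iInter fun b => ?_
      by_cases hb : b ∈ T.1
      · simpa [hb] using b.1.2.1
      · have : {x | x ∈ b.1.1 ↔ b ∈ T.1} = b.1.1ᶜ := by ext; simp [hb]
        rw [this]
        exact b.1.2.1.compl
    have hatom_sub : ∀ (T : ι) (b : J), b ∈ T.1 → atom T ⊆ b.1.1 :=
      fun T b hb x hx => (hx b).2 hb
    have hatom_disj : Pairwise fun S T => Disjoint (atom S) (atom T) := by
      intro S T hST
      refine Set.disjoint_left.2 fun x hS hT => hST ?_
      exact Subtype.ext (Finset.ext fun b => (hS b).symm.trans (hT b))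
    have hatom_vol : ∀ T, volume (atom T) ≠ ∞ := by
      rintro ⟨T, b, hb⟩
      exact ne_top_of_le_ne_top b.1.2.2 (measure_mono (hatom_sub ⟨T, b, hb⟩ b hb))
    let G : (ι → ℝ≥0∞) → (J → ℝ≥0∞) := fun v b => ∑ T with b ∈ T.1, v T
    have hG : Measurable G := by
      refine measurable_pi_lambda _ fun b => ?_
      exact Finset.measurable_sum _ fun T _ => measurable_pi_apply T
    have hA : Measurable (fun (ξ : Measure ℝ) (T : ι) => ξ (atom T)) :=
      measurable_pi_lambda _ fun T => Measure.measurable_coe (hatom_meas T)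
    have hfac : (J.restrict : (I → ℝ≥0∞) → (J → ℝ≥0∞)) ∘ Φ
        = G ∘ fun (ξ : Measure ℝ) (T : ι) => ξ (atom T) := by
      ext ξ b
      change ξ b.1.1 = ∑ T with b ∈ T.1, ξ (atom T)
      rw [← measure_biUnion_finset (fun S _ T _ hST => hatom_disj hST) fun T _ => hatom_meas T]
      congr 1
      ext x
      simp only [Set.mem_iUnion, Finset.mem_filter, Finset.mem_univ, true_and, exists_prop]
      constructor
      · intro hx
        refine ⟨⟨Finset.univ.filter fun c : J => x ∈ c.1.1, b, by simpa using hx⟩, ?_, ?_⟩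
        · simpa using hx
        · intro c
          simp
      · rintro ⟨T, hb, hx⟩
        exact hatom_sub T b hb hx
    rw [hfac, ← Measure.map_map hG hA, ← Measure.map_map hG hA,
      h ι atom hatom_meas hatom_vol hatom_disj]
  -- Sets of finite length suffice to generate the σ-algebra, since `ξ s` is the supremum of `ξ (s ∩
  -- [-n, n])`.
  have hle : (inferInstance : MeasurableSpace (Measure ℝ)) ≤
      MeasurableSpace.comap Φ MeasurableSpace.pi := by
    refine iSup₂_le fun s hs => ?_
    rw [← measurable_iff_comap_le]
    let b : ℕ → I := fun n => ⟨s ∩ Set.Icc (-n) n, hs.inter measurableSet_Icc,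
      ne_top_of_le_ne_top (by simp) (measure_mono (Set.inter_subset_right (s := s)))⟩
    have hsup : ∀ ξ : Measure ℝ, ξ s = ⨆ n, Φ ξ (b n) := by
      intro ξ
      have hmono : Monotone fun n => (b n).1 := by
        intro m n hmn
        have : (m : ℝ) ≤ n := by exact_mod_cast hmn
        exact Set.inter_subset_inter_right _ (Set.Icc_subset_Icc (neg_le_neg this) this)
      change ξ s = ⨆ n, ξ (b n).1
      rw [← hmono.measure_iUnion]
      congr 1
      ext x
      simp only [b, Set.mem_iUnion, Set.mem_inter_iff, Set.mem_Icc, exists_and_left]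
      obtain ⟨n, hn⟩ := exists_nat_ge |x|
      exact ⟨fun hx => ⟨hx, n, abs_le.1 hn⟩, fun hx => hx.1⟩
    simp_rw [hsup]
    refine Measurable.iSup fun n => ?_
    exact (measurable_pi_apply (b n)).comp (comap_measurable Φ)
  ext s hs
  obtain ⟨s', hs', rfl⟩ := hle s hs
  rw [← Measure.map_apply hΦ hs', ← Measure.map_apply hΦ hs', key]

/-- The law of the counting measure of a Poisson process is unique. -/
theorem IsUnitPoissonProcess.map_pointMeasure_unique {Ω Ω' : Type*} [MeasurableSpace Ω]
    [MeasurableSpace Ω'] {μ : Measure Ω} {μ' : Measure Ω'} [IsProbabilityMeasure μ]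
    [IsProbabilityMeasure μ'] {X : Ω → ℕ → ℝ} {X' : Ω' → ℕ → ℝ}
    (hX : IsUnitPoissonProcess μ X) (hX' : IsUnitPoissonProcess μ' X') :
    μ.map (fun ω => pointMeasure (X ω)) = μ'.map (fun ω => pointMeasure (X' ω)) := by
  have hm : Measurable fun ω => pointMeasure (X ω) := measurable_pointMeasure.comp hX.measurable
  have hm' : Measurable fun ω => pointMeasure (X' ω) := measurable_pointMeasure.comp hX'.measurable
  have := Measure.isProbabilityMeasure_map (μ := μ) hm.aemeasurable
  have := Measure.isProbabilityMeasure_map (μ := μ') hm'.aemeasurable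
  refine ext_of_map_disjoint fun ι _ B hB hv hd => ?_
  have hB' : Measurable fun (ξ : Measure ℝ) (i : ι) => ξ (B i) :=
    measurable_pi_lambda _ fun i => Measure.measurable_coe (hB i)
  rw [Measure.map_map hB' hm, Measure.map_map hB' hm']
  have h1 := (iIndepFun_iff_map_fun_eq_pi_map
    fun i => (hX.measurable_count (hB i)).aemeasurable).1 (hX.iIndepFun_count B hB hd)
  have h2 := (iIndepFun_iff_map_fun_eq_pi_map
    fun i => (hX'.measurable_count (hB i)).aemeasurable).1 (hX'.iIndepFun_count B hB hd)
  refine h1.trans (Eq.trans ?_ h2.symm)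
  congr 1
  ext1 i
  rw [hX.map_count (hB i) (hv i), hX'.map_count (hB i) (hv i)]

/-! ### Products of non-edge probabilities as exponentials of sums. -/

/-- The function `t ↦ exp (-t)` on `[0, ∞]`. -/
noncomputable def expNeg (t : ℝ≥0∞) : ℝ≥0∞ := EReal.exp (-(t : EReal))

lemma continuous_expNeg : Continuous expNeg :=
  ENNReal.continuous_exp.comp (continuous_neg.comp continuous_coe_ennreal_ereal)

lemma expNeg_zero : expNeg 0 = 1 := by simp [expNeg]

lemma expNeg_add (s t : ℝ≥0∞) : expNeg (s + t) = expNeg s * expNeg t := by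
  rw [expNeg, EReal.coe_ennreal_add, EReal.neg_add (by simp) (by simp), sub_eq_add_neg,
    EReal.exp_add]
  rfl

lemma expNeg_sum {ι : Type*} (s : Finset ι) (f : ι → ℝ≥0∞) :
    expNeg (∑ i ∈ s, f i) = ∏ i ∈ s, expNeg (f i) := by
  classical
  induction s using Finset.induction_on with
  | empty => simp [expNeg_zero]
  | insert a s ha ih => rw [Finset.sum_insert ha, Finset.prod_insert ha, expNeg_add, ih]

lemma expNeg_antitone : Antitone expNeg := fun s t h =>
  EReal.exp_monotone (EReal.neg_le_neg_iff.2 (by exact_mod_cast h))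

lemma expNeg_le_one (t : ℝ≥0∞) : expNeg t ≤ 1 := expNeg_zero ▸ expNeg_antitone zero_le

lemma expNeg_ofReal {r : ℝ} (hr : 0 ≤ r) :
    expNeg (ENNReal.ofReal r) = ENNReal.ofReal (Real.exp (-r)) := by
  rw [expNeg, EReal.coe_ennreal_ofReal, max_eq_left hr, ← EReal.coe_neg, EReal.exp_coe]

/-- The exponent `-log (1 - H |r|)` of the probability that two nodes at displacement `r` are not
joined. -/
noncomputable def edgeCost (H : ℝ → ℝ) (r : ℝ) : ℝ≥0∞ :=
  (ENNReal.log (ENNReal.ofReal (1 - H |r|))⁻¹).toENNReal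

/-- As `H ≥ 0`, the logarithm is nonnegative and `toENNReal` loses nothing. Where `H |r| = 1` the
cost is `∞` and both sides vanish. -/
lemma expNeg_edgeCost {H : ℝ → ℝ} (h0 : ∀ r, 0 ≤ H |r|) (r : ℝ) :
    expNeg (edgeCost H r) = ENNReal.ofReal (1 - H |r|) := by
  have h1 : ENNReal.ofReal (1 - H |r|) ≤ 1 := by
    rw [ENNReal.ofReal_le_one]
    linarith [h0 r]
  rw [expNeg, edgeCost, EReal.coe_toENNReal, ENNReal.log_inv, neg_neg, ENNReal.exp_log]
  rw [ENNReal.zero_le_log_iff]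
  exact ENNReal.one_le_inv.2 h1

lemma measurable_edgeCost {H : ℝ → ℝ} (hH : Measurable fun r => H |r|) :
    Measurable (edgeCost H) := by
  unfold edgeCost
  have h1 : Measurable fun r => (ENNReal.ofReal (1 - H |r|))⁻¹ :=
    (ENNReal.measurable_ofReal.comp (hH.const_sub 1)).inv
  exact (ENNReal.continuous_log.measurable.comp h1).ereal_toENNReal

/-- This is `1 - x ≤ exp (-x)`, read through the strictly monotone exponential. -/
lemma ofReal_le_edgeCost {H : ℝ → ℝ} (h0 : ∀ r, 0 ≤ H |r|) (r : ℝ) :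
    ENNReal.ofReal (H |r|) ≤ edgeCost H r := by
  have h : EReal.exp (-(edgeCost H r : EReal)) ≤ EReal.exp (-(ENNReal.ofReal (H |r|) : EReal)) := by
    change expNeg _ ≤ expNeg _
    rw [expNeg_edgeCost h0, expNeg_ofReal (h0 r)]
    refine ENNReal.ofReal_le_ofReal ?_
    linarith [Real.add_one_le_exp (-H |r|)]
  rw [EReal.exp_le_exp_iff, EReal.neg_le_neg_iff] at h
  exact_mod_cast h

/-- The total exponent of the pairs of points of `ξ` that straddle `y`. -/
noncomputable def crossCost (H : ℝ → ℝ) (ξ : Measure ℝ) (y : ℝ) : ℝ≥0∞ :=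
  ∫⁻ u, ∫⁻ v, if u ≤ y ∧ y < v then edgeCost H (v - u) else 0 ∂ξ ∂ξ

lemma sum_range_symm (n : ℕ) (F : ℕ → ℕ → ℝ≥0∞) (hF : ∀ j, F j j = 0) :
    ∑ e ∈ (Finset.range n ×ˢ Finset.range n).filter (fun e => e.1 < e.2), (F e.1 e.2 + F e.2 e.1)
      = ∑ e ∈ Finset.range n ×ˢ Finset.range n, F e.1 e.2 := by
  rw [Finset.sum_filter, Finset.sum_product, Finset.sum_product]
  have h1 : ∀ j k, F j k = (if j < k then F j k else 0) + (if k < j then F j k else 0) := by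
    intro j k
    rcases lt_trichotomy j k with h | rfl | h
    · simp [h, h.not_gt]
    · simp [hF]
    · simp [h, h.not_gt]
  conv_rhs => enter [2, j, 2, k]; rw [h1 j k]
  simp_rw [Finset.sum_add_distrib]
  conv_rhs => enter [2]; rw [Finset.sum_comm]
  simp_rw [← Finset.sum_add_distrib]
  refine Finset.sum_congr rfl fun j _ => Finset.sum_congr rfl fun k _ => ?_
  split_ifs <;> simp

lemma tendsto_range_product_range :
    Tendsto (fun n : ℕ => Finset.range n ×ˢ Finset.range n) atTop atTop := by
  refine tendsto_atTop_finset_of_monotone (fun m n hmn => ?_) fun e => ?_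
  · exact Finset.product_subset_product (Finset.range_mono hmn) (Finset.range_mono hmn)
  · exact ⟨max e.1 e.2 + 1, by simp⟩

/-- Node `j` is weakly to the left and node `k` strictly to the right of node `i`. -/
def Straddles (x : ℕ → ℝ) (i j k : ℕ) : Prop := x j ≤ x i ∧ x i < x k

/-- The configurations in which the pair `e` straddles node `i`. -/
def straddleSet (i : ℕ) (e : ℕ × ℕ) : Set (ℕ → ℝ) :=
  {x | Straddles x i e.1 e.2 ∨ Straddles x i e.2 e.1}

lemma measurableSet_straddleSet (i : ℕ) (e : ℕ × ℕ) : MeasurableSet (straddleSet i e) := by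
  have h : ∀ j k : ℕ, MeasurableSet {x : ℕ → ℝ | Straddles x i j k} := fun j k =>
    (measurableSet_le (measurable_pi_apply j) (measurable_pi_apply i)).inter
      (measurableSet_lt (measurable_pi_apply i) (measurable_pi_apply k))
  exact (h _ _).union (h _ _)

open scoped Classical in
-- Every factor is `expNeg` of a cost, so a partial product is `expNeg` of a partial sum over a
-- square of indices. These squares are cofinal among finite sets, and `expNeg` is continuous on all
-- of `[0, ∞]`, so a divergent sum needs no separate treatment.
lemma tendsto_prod_straddle {H : ℝ → ℝ} (h0 : ∀ r, 0 ≤ H |r|) (x : ℕ → ℝ) (i : ℕ) :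
    Tendsto (fun n : ℕ => ∏ e ∈ (Finset.range n ×ˢ Finset.range n).filter (fun e => e.1 < e.2),
        ENNReal.ofReal (1 - (straddleSet i e).indicator 1 x * H |x e.1 - x e.2|))
      atTop (𝓝 (expNeg (crossCost H (pointMeasure x) (x i)))) := by
  set F : ℕ → ℕ → ℝ≥0∞ := fun j k =>
    if x j ≤ x i ∧ x i < x k then edgeCost H (x k - x j) else 0 with hF
  have h1 : ∀ e : ℕ × ℕ,
      ENNReal.ofReal (1 - (straddleSet i e).indicator 1 x * H |x e.1 - x e.2|)
        = expNeg (F e.1 e.2 + F e.2 e.1) := by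
    intro e
    by_cases ha : x e.1 ≤ x i ∧ x i < x e.2
    -- A pair can straddle in one orientation only, so at most one of the two costs is present.
    · have hb : ¬ (x e.2 ≤ x i ∧ x i < x e.1) := fun hb => (hb.2.trans_le ha.1).false
      have hm : x ∈ straddleSet i e := Or.inl ha
      rw [Set.indicator_of_mem hm]
      simp only [hF]
      rw [if_pos ha, if_neg hb, add_zero, expNeg_edgeCost h0, abs_sub_comm]
      simp
    · by_cases hb : x e.2 ≤ x i ∧ x i < x e.1
      · have hm : x ∈ straddleSet i e := Or.inr hb
        rw [Set.indicator_of_mem hm]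
        simp only [hF]
        rw [if_neg ha, if_pos hb, zero_add, expNeg_edgeCost h0]
        simp
      · have hm : x ∉ straddleSet i e := fun h => h.elim ha hb
        rw [Set.indicator_of_notMem hm]
        simp only [hF]
        rw [if_neg ha, if_neg hb, zero_add, expNeg_zero]
        simp
  simp_rw [h1]
  have h2 : ∀ n : ℕ, ∏ e ∈ (Finset.range n ×ˢ Finset.range n).filter (fun e => e.1 < e.2),
      expNeg (F e.1 e.2 + F e.2 e.1)
      = expNeg (∑ e ∈ Finset.range n ×ˢ Finset.range n, F e.1 e.2) := by
    intro n
    rw [← expNeg_sum, sum_range_symm n F fun j => by simp [hF]]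
  simp_rw [h2]
  refine (continuous_expNeg.tendsto _).comp ?_
  have h3 : crossCost H (pointMeasure x) (x i) = ∑' e : ℕ × ℕ, F e.1 e.2 := by
    rw [crossCost, lintegral_pointMeasure, ENNReal.tsum_prod (f := F)]
    simp_rw [lintegral_pointMeasure]
    rfl
  rw [h3]
  exact ENNReal.summable.hasSum.comp tendsto_range_product_range

/-! ### Gap events and integrating out the edges. -/

section Events

variable {Ω : Type*}

/-- The event that the pair `e` is joined. -/
def adjSet (g : Ω → SpatialGraph) (e : ℕ × ℕ) : Set Ω := {ω | (g ω).graph.Adj e.1 e.2}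

/-- The event that no edge crosses the node `i`. -/
def gapSet (g : Ω → SpatialGraph) (i : ℕ) : Set Ω :=
  {ω | ∀ j k : ℕ, (g ω).pos j ≤ (g ω).pos i → (g ω).pos i < (g ω).pos k → ¬ (g ω).graph.Adj j k}

/-- The event that no edge between two of the first `n` nodes crosses the node `i`. -/
def partialGapSet (g : Ω → SpatialGraph) (i n : ℕ) : Set Ω :=
  {ω | ∀ e ∈ (Finset.range n ×ˢ Finset.range n).filter (fun e => e.1 < e.2),
    (g ω).pos ∈ straddleSet i e → ω ∉ adjSet g e}

lemma gapSet_eq_iInter (g : Ω → SpatialGraph) (i : ℕ) : gapSet g i = ⋂ n, partialGapSet g i n := by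
  ext ω
  simp only [Set.mem_iInter]
  constructor
  · rintro h n e _ (he | he) ha
    · exact h _ _ he.1 he.2 ha
    · exact h _ _ he.1 he.2 (SimpleGraph.Adj.symm ha)
  · intro h j k hj hk ha
    rcases lt_trichotomy j k with hjk | rfl | hjk
    · exact h (k + 1) (j, k) (by simp; omega) (Or.inl ⟨hj, hk⟩) ha
    · exact ha.ne rfl
    · exact h (j + 1) (k, j) (by simp; omega) (Or.inr ⟨hj, hk⟩) ha.symm

lemma antitone_partialGapSet (g : Ω → SpatialGraph) (i : ℕ) : Antitone (partialGapSet g i) := by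
  intro m n hmn ω h e he
  refine h e ?_
  simp only [Finset.mem_filter, Finset.mem_product, Finset.mem_range] at he ⊢
  omega

end Events

section Edges

variable {Ω : Type*} [mΩ : MeasurableSpace Ω] {μ : Measure Ω}
  {H : ℝ → ℝ} {g : Ω → SpatialGraph}

lemma IsSoftRGG.measurable_pos (hg : IsSoftRGG μ H g) : Measurable fun ω => (g ω).pos :=
  hg.nodes.measurable

/-- A bounded factor depending only on the positions is pulled out of the conditional expectation.
-/
lemma IsSoftRGG.integral_mul_prod_adj [IsProbabilityMeasure μ] (hg : IsSoftRGG μ H g) {Z : (ℕ → ℝ) → ℝ}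
    (hZ : Measurable Z) {C : ℝ} (hC : ∀ x, |Z x| ≤ C) (T : Finset (ℕ × ℕ))
    (hT : ∀ e ∈ T, e.1 < e.2) :
    ∫ ω, Z (g ω).pos * ∏ e ∈ T, (adjSet g e).indicator 1 ω ∂μ
      = ∫ ω, Z (g ω).pos * ∏ e ∈ T, H |(g ω).pos e.1 - (g ω).pos e.2| ∂μ := by
  classical
  have hm : MeasurableSpace.comap (fun ω => (g ω).pos) MeasurableSpace.pi ≤ mΩ :=
    hg.measurable_pos.comap_le
  set s : Set Ω := {ω | ∀ e ∈ T, (g ω).graph.Adj e.1 e.2} with hs_def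
  have hs : MeasurableSet s := by
    have : s = ⋂ e ∈ T, {ω | (g ω).graph.Adj e.1 e.2} := by ext; simp [hs_def]
    rw [this]
    exact MeasurableSet.biInter T.countable_toSet fun e _ => hg.measurableSet_adj _ _
  have hind : ∀ ω, ∏ e ∈ T, (adjSet g e).indicator (1 : Ω → ℝ) ω
      = s.indicator (fun _ => (1 : ℝ)) ω := by
    intro ω
    by_cases hω : ω ∈ s
    · rw [Set.indicator_of_mem hω]
      refine Finset.prod_eq_one fun e he => ?_
      have h : ω ∈ adjSet g e := hω e he
      rw [Set.indicator_of_mem h, Pi.one_apply]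
    · rw [Set.indicator_of_notMem hω]
      have : ∃ e ∈ T, ¬ (g ω).graph.Adj e.1 e.2 := by
        by_contra! hcon
        exact hω hcon
      obtain ⟨e, he, hne⟩ := this
      have h : ω ∉ adjSet g e := hne
      exact Finset.prod_eq_zero he (Set.indicator_of_notMem h _)
  simp_rw [hind]
  have hZm : StronglyMeasurable[MeasurableSpace.comap (fun ω => (g ω).pos) MeasurableSpace.pi] fun ω => Z (g ω).pos :=
    (hZ.comp (comap_measurable _)).stronglyMeasurable
  have hint : Integrable (s.indicator fun _ => (1 : ℝ)) μ :=
    (integrable_const (1 : ℝ)).indicator hs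
  have hint2 : Integrable ((fun ω => Z (g ω).pos) * s.indicator fun _ => (1 : ℝ)) μ :=
    hint.bdd_mul (hZ.comp hg.measurable_pos).aestronglyMeasurable
      (ae_of_all _ fun ω => hC (g ω).pos)
  have h1 := condExp_mul_of_stronglyMeasurable_left hZm hint2 hint
  calc ∫ ω, Z (g ω).pos * s.indicator (fun _ => (1 : ℝ)) ω ∂μ
      = ∫ ω, (μ[(fun ω => Z (g ω).pos) * s.indicator fun _ => (1 : ℝ) |
          MeasurableSpace.comap (fun ω => (g ω).pos) MeasurableSpace.pi]) ω ∂μ :=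
        (integral_condExp hm).symm
    _ = _ := by
      refine integral_congr_ae ?_
      filter_upwards [h1, hg.edges T hT] with ω h1 h2
      rw [h1, Pi.mul_apply]
      congr 1

lemma measurable_prod_edge (hH : Measurable fun r => H |r|) (T : Finset (ℕ × ℕ)) :
    Measurable fun x : ℕ → ℝ => ∏ e ∈ T, H |x e.1 - x e.2| :=
  Finset.measurable_prod _ fun e _ =>
    hH.comp ((measurable_pi_apply e.1).sub (measurable_pi_apply e.2))

/-- The model prescribes only the conditional probability that all edges of a finite set are
present. Inclusion-exclusion, in the form of expanding the product over subsets `T`, turns this into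
the probability that unwanted edges are absent. -/
lemma IsSoftRGG.integral_prod_one_sub [IsProbabilityMeasure μ] (hg : IsSoftRGG μ H g) (hH : Measurable fun r => H |r|)
    (h01 : ∀ r, H |r| ∈ Set.Icc (0 : ℝ) 1) {C : Set (ℕ → ℝ)} (hC : MeasurableSet C)
    {D : ℕ × ℕ → Set (ℕ → ℝ)} (hD : ∀ e, MeasurableSet (D e)) (S : Finset (ℕ × ℕ))
    (hS : ∀ e ∈ S, e.1 < e.2) :
    ∫ ω, C.indicator 1 (g ω).pos *
        ∏ e ∈ S, (1 - (D e).indicator 1 (g ω).pos * (adjSet g e).indicator 1 ω) ∂μ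
      = ∫ ω, C.indicator 1 (g ω).pos *
        ∏ e ∈ S, (1 - (D e).indicator 1 (g ω).pos * H |(g ω).pos e.1 - (g ω).pos e.2|) ∂μ := by
  have hexp : ∀ (d a : ℕ × ℕ → ℝ) (c : ℝ), c * ∏ e ∈ S, (1 - d e * a e)
      = ∑ T ∈ S.powerset, (c * ∏ e ∈ T, -d e) * ∏ e ∈ T, a e := by
    intro d a c
    have : ∀ e, 1 - d e * a e = -d e * a e + 1 := fun e => by ring
    simp_rw [this]
    rw [Finset.prod_add_one, Finset.mul_sum]
    simp_rw [Finset.prod_mul_distrib, mul_assoc]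
  have hZ : ∀ T : Finset (ℕ × ℕ), Measurable fun x : ℕ → ℝ =>
      C.indicator (1 : (ℕ → ℝ) → ℝ) x * ∏ e ∈ T, -(D e).indicator 1 x := fun T =>
    (measurable_one.indicator hC).mul
      (Finset.measurable_prod _ fun e _ => (measurable_one.indicator (hD e)).neg)
  have hind : ∀ (A : Set (ℕ → ℝ)) x, |A.indicator (1 : (ℕ → ℝ) → ℝ) x| ≤ 1 := by
    intro A x
    by_cases hx : x ∈ A <;> simp [hx]
  have hZ1 : ∀ (T : Finset (ℕ × ℕ)) (x : ℕ → ℝ),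
      |C.indicator (1 : (ℕ → ℝ) → ℝ) x * ∏ e ∈ T, -(D e).indicator 1 x| ≤ 1 := by
    intro T x
    rw [abs_mul, Finset.abs_prod]
    refine mul_le_one₀ (hind C x) (Finset.prod_nonneg fun _ _ => abs_nonneg _) ?_
    exact Finset.prod_le_one (fun _ _ => abs_nonneg _) fun e _ => by
      rw [abs_neg]; exact hind _ x
  have hA : ∀ T : Finset (ℕ × ℕ), Measurable fun ω => ∏ e ∈ T, (adjSet g e).indicator (1 : Ω → ℝ) ω :=
    fun T => Finset.measurable_prod _ fun e _ =>
      measurable_one.indicator (hg.measurableSet_adj e.1 e.2)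
  simp_rw [hexp]
  rw [integral_finsetSum, integral_finsetSum]
  · exact Finset.sum_congr rfl fun T hT => hg.integral_mul_prod_adj (hZ T) (hZ1 T) T
      fun e he => hS e (Finset.mem_powerset.1 hT he)
  · intro T _
    refine Integrable.of_bound (C := 1)
      (((hZ T).comp hg.measurable_pos).mul
        ((measurable_prod_edge hH T).comp hg.measurable_pos)).aestronglyMeasurable
      (ae_of_all _ fun ω => ?_)
    rw [Real.norm_eq_abs, abs_mul]
    refine mul_le_one₀ (hZ1 T _) (abs_nonneg _) ?_
    rw [Finset.abs_prod]
    exact Finset.prod_le_one (fun _ _ => abs_nonneg _) fun e _ => by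
      rw [abs_of_nonneg (h01 _).1]; exact (h01 _).2
  · intro T _
    refine Integrable.of_bound (C := 1)
      (((hZ T).comp hg.measurable_pos).mul (hA T)).aestronglyMeasurable
      (ae_of_all _ fun ω => ?_)
    rw [Real.norm_eq_abs, abs_mul]
    refine mul_le_one₀ (hZ1 T _) (abs_nonneg _) ?_
    rw [Finset.abs_prod]
    refine Finset.prod_le_one (fun _ _ => abs_nonneg _) fun e _ => ?_
    by_cases h : ω ∈ adjSet g e <;> simp [h]

lemma IsSoftRGG.measurableSet_partialGapSet (hg : IsSoftRGG μ H g) (i n : ℕ) :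
    MeasurableSet (partialGapSet g i n) := by
  have : partialGapSet g i n
      = ⋂ e ∈ (Finset.range n ×ˢ Finset.range n).filter (fun e : ℕ × ℕ => e.1 < e.2),
        ((fun ω => (g ω).pos) ⁻¹' straddleSet i e)ᶜ ∪ (adjSet g e)ᶜ := by
    ext ω
    simp only [partialGapSet, Set.mem_iInter, Set.mem_ofPred_eq, Set.mem_union, Set.mem_compl_iff,
      Set.mem_preimage]
    exact forall₂_congr fun e _ => imp_iff_not_or
  rw [this]
  exact Finset.measurableSet_biInter _ fun e _ =>
    (hg.measurable_pos (measurableSet_straddleSet i e)).compl.union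
      (hg.measurableSet_adj e.1 e.2).compl

lemma IsSoftRGG.measurableSet_gapSet (hg : IsSoftRGG μ H g) (i : ℕ) :
    MeasurableSet (gapSet g i) := by
  rw [gapSet_eq_iInter]
  exact MeasurableSet.iInter fun n => hg.measurableSet_partialGapSet i n

lemma IsSoftRGG.measure_partialGapSet [IsProbabilityMeasure μ] (hg : IsSoftRGG μ H g) (hH : Measurable fun r => H |r|)
    (h01 : ∀ r, H |r| ∈ Set.Icc (0 : ℝ) 1) {B : Set ℝ} (hB : MeasurableSet B) (i n : ℕ) :
    μ ({ω | (g ω).pos i ∈ B} ∩ partialGapSet g i n)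
      = ∫⁻ ω, B.indicator 1 ((g ω).pos i) *
        ∏ e ∈ (Finset.range n ×ˢ Finset.range n).filter (fun e => e.1 < e.2),
          ENNReal.ofReal (1 - (straddleSet i e).indicator 1 (g ω).pos
            * H |(g ω).pos e.1 - (g ω).pos e.2|) ∂μ := by
  classical
  set S := (Finset.range n ×ˢ Finset.range n).filter (fun e : ℕ × ℕ => e.1 < e.2) with hS
  set C : Set (ℕ → ℝ) := {x | x i ∈ B} with hC_def
  have hC : MeasurableSet C := measurable_pi_apply i hB
  have h := hg.integral_prod_one_sub hH h01 hC (measurableSet_straddleSet i) S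
    (fun e he => (Finset.mem_filter.1 he).2)
  have hE : MeasurableSet ({ω | (g ω).pos i ∈ B} ∩ partialGapSet g i n) :=
    (hg.measurable_pos hC).inter (hg.measurableSet_partialGapSet i n)
  -- The indicator of having no crossing edge is a product of `1 - 1_straddle * 1_adj`, the form in
  -- which the edges can be integrated out.
  have hl : ∀ ω, C.indicator (1 : (ℕ → ℝ) → ℝ) (g ω).pos *
        ∏ e ∈ S, (1 - (straddleSet i e).indicator 1 (g ω).pos * (adjSet g e).indicator 1 ω)
      = ({ω | (g ω).pos i ∈ B} ∩ partialGapSet g i n).indicator (1 : Ω → ℝ) ω := by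
    intro ω
    by_cases h1 : (g ω).pos i ∈ B
    · have h1' : (g ω).pos ∈ C := h1
      rw [Set.indicator_of_mem h1', Pi.one_apply, one_mul]
      by_cases h2 : ω ∈ partialGapSet g i n
      · have h12 : ω ∈ {ω | (g ω).pos i ∈ B} ∩ partialGapSet g i n := ⟨h1, h2⟩
        rw [Set.indicator_of_mem h12]
        refine Finset.prod_eq_one fun e he => ?_
        by_cases h3 : (g ω).pos ∈ straddleSet i e
        · rw [Set.indicator_of_notMem (h2 e he h3) (1 : Ω → ℝ)]
          simp
        · rw [Set.indicator_of_notMem h3]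
          simp
      · rw [Set.indicator_of_notMem fun h => h2 h.2]
        have : ∃ e ∈ S, (g ω).pos ∈ straddleSet i e ∧ ω ∈ adjSet g e := by
          by_contra! hcon
          exact h2 hcon
        obtain ⟨e, he, h3, h4⟩ := this
        refine Finset.prod_eq_zero he ?_
        rw [Set.indicator_of_mem h3, Set.indicator_of_mem h4]
        simp
    · have h1' : (g ω).pos ∉ C := h1
      rw [Set.indicator_of_notMem h1', Set.indicator_of_notMem fun h => h1 h.1, zero_mul]
  simp_rw [hl] at h
  rw [integral_indicator_one hE] at h
  have hfac : ∀ ω e, 0 ≤ 1 - (straddleSet i e).indicator 1 (g ω).pos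
      * H |(g ω).pos e.1 - (g ω).pos e.2| ∧ 1 - (straddleSet i e).indicator 1 (g ω).pos
      * H |(g ω).pos e.1 - (g ω).pos e.2| ≤ 1 := by
    intro ω e
    have := h01 ((g ω).pos e.1 - (g ω).pos e.2)
    by_cases h3 : (g ω).pos ∈ straddleSet i e
    · simp [h3, this.1, this.2]
    · simp [h3]
  have hCi : ∀ x, 0 ≤ C.indicator (1 : (ℕ → ℝ) → ℝ) x ∧ C.indicator (1 : (ℕ → ℝ) → ℝ) x ≤ 1 := by
    intro x
    by_cases hx : x ∈ C <;> simp [hx]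
  rw [← ofReal_measureReal, h, ofReal_integral_eq_lintegral_ofReal]
  · refine lintegral_congr fun ω => ?_
    rw [ENNReal.ofReal_mul (hCi _).1, ENNReal.ofReal_prod_of_nonneg fun e _ => (hfac ω e).1]
    congr 1
    by_cases h1 : (g ω).pos i ∈ B
    · have h1' : (g ω).pos ∈ C := h1
      simp [h1, h1']
    · have h1' : (g ω).pos ∉ C := h1
      simp [h1, h1']
  · refine Integrable.of_bound (C := 1) (Measurable.aestronglyMeasurable ?_)
      (ae_of_all _ fun ω => ?_)
    · refine ((measurable_one.indicator hC).comp hg.measurable_pos).mul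
        (Finset.measurable_prod _ fun e _ => Measurable.const_sub ?_ 1)
      refine ((measurable_one.indicator (measurableSet_straddleSet i e)).comp
        hg.measurable_pos).mul ?_
      exact (hH.comp ((measurable_pi_apply e.1).sub (measurable_pi_apply e.2))).comp
        hg.measurable_pos
    · rw [Real.norm_eq_abs, abs_of_nonneg
        (mul_nonneg (hCi _).1 (Finset.prod_nonneg fun e _ => (hfac ω e).1))]
      exact mul_le_one₀ (hCi _).2 (Finset.prod_nonneg fun e _ => (hfac ω e).1)
        (Finset.prod_le_one (fun e _ => (hfac ω e).1) fun e _ => (hfac ω e).2)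
  · exact ae_of_all _ fun ω =>
      mul_nonneg (hCi _).1 (Finset.prod_nonneg fun e _ => (hfac ω e).1)

/-- The probability that node `i` lies in `B` and marks an uncrossed gap, with the edges
integrated out. -/
theorem IsSoftRGG.measure_gapSet [IsProbabilityMeasure μ] (hg : IsSoftRGG μ H g) (hH : Measurable fun r => H |r|)
    (h01 : ∀ r, H |r| ∈ Set.Icc (0 : ℝ) 1) {B : Set ℝ} (hB : MeasurableSet B) (i : ℕ) :
    μ ({ω | (g ω).pos i ∈ B} ∩ gapSet g i)
      = ∫⁻ ω, B.indicator 1 ((g ω).pos i) *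
        expNeg (crossCost H (pointMeasure (g ω).pos) ((g ω).pos i)) ∂μ := by
  have hBi : MeasurableSet {ω | (g ω).pos i ∈ B} :=
    hg.measurable_pos (measurable_pi_apply i hB)
  have h1 : Tendsto (fun n => μ ({ω | (g ω).pos i ∈ B} ∩ partialGapSet g i n)) atTop
      (𝓝 (μ ({ω | (g ω).pos i ∈ B} ∩ gapSet g i))) := by
    rw [gapSet_eq_iInter, Set.inter_iInter]
    refine tendsto_measure_iInter_atTop
      (fun n => (hBi.inter (hg.measurableSet_partialGapSet i n)).nullMeasurableSet)
      (fun m n hmn => Set.inter_subset_inter_right _ (antitone_partialGapSet g i hmn))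
      ⟨0, measure_ne_top _ _⟩
  refine tendsto_nhds_unique h1 ?_
  simp_rw [hg.measure_partialGapSet hH h01 hB i]
  refine tendsto_lintegral_of_dominated_convergence (fun _ => 1) (fun n => ?_)
    (fun n => ae_of_all _ fun ω => ?_) (by simp) (ae_of_all _ fun ω => ?_)
  · refine ((measurable_one.indicator hB).comp
      ((measurable_pi_apply i).comp hg.measurable_pos)).mul
        (Finset.measurable_prod _ fun e _ =>
          ENNReal.measurable_ofReal.comp (Measurable.const_sub ?_ 1))
    refine ((measurable_one.indicator (measurableSet_straddleSet i e)).comp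
      hg.measurable_pos).mul ?_
    exact (hH.comp ((measurable_pi_apply e.1).sub (measurable_pi_apply e.2))).comp
      hg.measurable_pos
  · refine mul_le_one' (Set.indicator_le_self' (by simp) _) (Finset.prod_le_one' fun e _ => ?_)
    rw [ENNReal.ofReal_le_one]
    have := h01 ((g ω).pos e.1 - (g ω).pos e.2)
    by_cases h3 : (g ω).pos ∈ straddleSet i e
    · simp [h3, this.1]
    · simp [h3]
  · refine ENNReal.Tendsto.const_mul (tendsto_prod_straddle (fun r => (h01 r).1) _ i) ?_
    right
    exact ne_top_of_le_ne_top ENNReal.one_ne_top (Set.indicator_le_self' (by simp) _)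

end Edges

/-! ### Measurability in the point measure, by way of an s-finite kernel. -/

/-- The measures whose mass on `[m, m + 1)` lies in `[k, k + 1)`. -/
def cellMassSet (p : ℤ × ℕ) : Set (Measure ℝ) :=
  (fun ξ => ξ (Set.Ico (p.1 : ℝ) (p.1 + 1))) ⁻¹' Set.Ico (p.2 : ℝ≥0∞) (p.2 + 1)

lemma measurableSet_cellMassSet (p : ℤ × ℕ) : MeasurableSet (cellMassSet p) :=
  Measure.measurable_coe measurableSet_Ico measurableSet_Ico

open scoped Classical in
/-- The restriction of a measure to `[m, m + 1)` if its mass there lies in `[k, k + 1)`. -/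
noncomputable def cellKernel (p : ℤ × ℕ) : Kernel (Measure ℝ) ℝ :=
  Kernel.piecewise (measurableSet_cellMassSet p)
    (Kernel.restrict (⟨id, measurable_id⟩ : Kernel (Measure ℝ) ℝ)
      (measurableSet_Ico (a := (p.1 : ℝ)) (b := p.1 + 1))) 0

instance (p : ℤ × ℕ) : IsFiniteKernel (cellKernel p) := by
  classical
  refine ⟨p.2 + 1, by simp, fun ξ => ?_⟩
  rw [cellKernel, Kernel.piecewise_apply]
  split_ifs with h
  · rw [Kernel.restrict_apply, Measure.restrict_apply_univ]
    exact h.2.le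
  · simp

/-- An s-finite kernel which agrees with the identity on measures that are finite on unit cells. -/
noncomputable def idKernel : Kernel (Measure ℝ) ℝ := Kernel.sum cellKernel

instance : IsSFiniteKernel idKernel := by unfold idKernel; infer_instance

lemma idKernel_apply {ξ : Measure ℝ} (hξ : ∀ m : ℤ, ξ (Set.Ico (m : ℝ) (m + 1)) < ∞) :
    idKernel ξ = ξ := by
  classical
  ext s hs
  have h1 : ∀ m : ℤ, ∑' k : ℕ, cellKernel (m, k) ξ s = ξ (s ∩ Set.Ico (m : ℝ) (m + 1)) := by
    intro m
    have hk : ∀ k : ℕ, cellKernel (m, k) ξ s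
        = if ξ ∈ cellMassSet (m, k) then ξ (s ∩ Set.Ico (m : ℝ) (m + 1)) else 0 := by
      intro k
      rw [cellKernel, Kernel.piecewise_apply]
      split_ifs
      · rw [Kernel.restrict_apply, Measure.restrict_apply hs]
        rfl
      · simp
    obtain ⟨a, ha⟩ : ∃ a : NNReal, ξ (Set.Ico (m : ℝ) (m + 1)) = a :=
      ⟨_, (ENNReal.coe_toNNReal (hξ m).ne).symm⟩
    -- A finite mass lies in exactly one interval `[k, k + 1)`, so a single kernel per unit cell
    -- contributes.
    have hmem : ∀ k : ℕ, ξ ∈ cellMassSet (m, k) ↔ k = ⌊a⌋₊ := by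
      intro k
      rw [eq_comm, Nat.floor_eq_iff (zero_le)]
      simp only [cellMassSet, Set.mem_preimage, Set.mem_Ico]
      rw [ha]
      norm_cast
    simp_rw [hk, hmem]
    rw [tsum_ite_eq]
  rw [idKernel, Kernel.sum_apply' _ _ hs, ENNReal.tsum_prod (f := fun m k => cellKernel (m, k) ξ s)]
  simp_rw [h1]
  rw [← measure_iUnion]
  · rw [← Set.inter_iUnion, iUnion_Ico_intCast, Set.inter_univ]
  · intro m n hmn
    exact (Set.pairwise_disjoint_Ico_intCast ℝ hmn).mono Set.inter_subset_right Set.inter_subset_right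
  · exact fun m => hs.inter measurableSet_Ico

/-- The mean number of uncrossed gaps in `B` given that the nodes form the point measure `ξ`. -/
noncomputable def gapFunctional (H : ℝ → ℝ) (B : Set ℝ) (ξ : Measure ℝ) : ℝ≥0∞ :=
  ∫⁻ y, B.indicator 1 y * expNeg (crossCost H ξ y) ∂ξ

/-- The crossing cost involves only order and differences of positions, so moving the points amounts
to moving the window. -/
lemma gapFunctional_sub (H : ℝ → ℝ) (B : Set ℝ) (x : ℕ → ℝ) (t : ℝ) :
    gapFunctional H B (pointMeasure fun i => x i - t)
      = gapFunctional H ((fun y => y - t) ⁻¹' B) (pointMeasure x) := by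
  rw [gapFunctional, lintegral_pointMeasure_sub]
  have h : ∀ y, crossCost H (pointMeasure fun i => x i - t) (y - t)
      = crossCost H (pointMeasure x) y := by
    intro y
    rw [crossCost, lintegral_pointMeasure_sub]
    simp_rw [lintegral_pointMeasure_sub]
    simp [crossCost]
  simp_rw [h]
  rfl

/-- The iterated integrals depend on `ξ` through both integrand and measure. Joint measurability is
available for s-finite kernels, which is the reason for `idKernel`. -/
lemma measurable_gapFunctional_idKernel {H : ℝ → ℝ} (hH : Measurable fun r => H |r|) {B : Set ℝ}
    (hB : MeasurableSet B) : Measurable fun ξ => gapFunctional H B (idKernel ξ) := by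
  unfold gapFunctional
  have h1 : Measurable fun p : (((Measure ℝ) × ℝ) × ℝ) × ℝ =>
      if p.1.2 ≤ p.1.1.2 ∧ p.1.1.2 < p.2 then edgeCost H (p.2 - p.1.2) else 0 := by
    refine Measurable.ite ?_ ((measurable_edgeCost hH).comp (by fun_prop)) measurable_const
    have hu : Measurable fun p : (((Measure ℝ) × ℝ) × ℝ) × ℝ => p.1.2 := by fun_prop
    have hy : Measurable fun p : (((Measure ℝ) × ℝ) × ℝ) × ℝ => p.1.1.2 := by fun_prop
    exact (measurableSet_le hu hy).inter (measurableSet_lt hy measurable_snd)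
  have h2 : Measurable fun p : ((Measure ℝ) × ℝ) × ℝ =>
      ∫⁻ v, (if p.2 ≤ p.1.2 ∧ p.1.2 < v then edgeCost H (v - p.2) else 0) ∂idKernel p.1.1 :=
    Measurable.lintegral_kernel_prod_right (κ := idKernel.comap
      (fun p : ((Measure ℝ) × ℝ) × ℝ => p.1.1) (by fun_prop)) (f := fun p v =>
        if p.2 ≤ p.1.2 ∧ p.1.2 < v then edgeCost H (v - p.2) else 0) h1
  have h3 : Measurable fun p : (Measure ℝ) × ℝ => crossCost H (idKernel p.1) p.2 :=
    Measurable.lintegral_kernel_prod_right (κ := idKernel.comap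
      (fun p : (Measure ℝ) × ℝ => p.1) (by fun_prop)) (f := fun p u =>
        ∫⁻ v, (if u ≤ p.2 ∧ p.2 < v then edgeCost H (v - u) else 0) ∂idKernel p.1) h2
  exact Measurable.lintegral_kernel_prod_right (κ := idKernel)
    (f := fun ξ y => B.indicator 1 y * expNeg (crossCost H (idKernel ξ) y))
    (((measurable_one.indicator hB).comp measurable_snd).mul
      (continuous_expNeg.measurable.comp h3))

/-! ### Intensity of the gaps, stationarity and the Palm probability. -/

section Intensity

variable {Ω : Type*} [MeasurableSpace Ω] {μ : Measure Ω} {X : Ω → ℕ → ℝ}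

lemma IsUnitPoissonProcess.ae_idKernel [IsProbabilityMeasure μ] (hX : IsUnitPoissonProcess μ X) :
    ∀ᵐ ω ∂μ, idKernel (pointMeasure (X ω)) = pointMeasure (X ω) := by
  have : ∀ᵐ ω ∂μ, ∀ m : ℤ, pointMeasure (X ω) (Set.Ico (m : ℝ) (m + 1)) < ∞ :=
    ae_all_iff.2 fun m => hX.ae_count_lt_top measurableSet_Ico (by simp)
  filter_upwards [this] with ω hω
  exact idKernel_apply hω

/-- Shifting the window is shifting the nodes. The shifted nodes are again unit Poisson, and their
counting measure has the same law even though the enumeration may not. -/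
lemma IsUnitPoissonProcess.lintegral_gapFunctional_sub [IsProbabilityMeasure μ]
    (hX : IsUnitPoissonProcess μ X) {H : ℝ → ℝ} (hH : Measurable fun r => H |r|) {B : Set ℝ}
    (hB : MeasurableSet B) (t : ℝ) :
    ∫⁻ ω, gapFunctional H ((fun y => y - t) ⁻¹' B) (pointMeasure (X ω)) ∂μ
      = ∫⁻ ω, gapFunctional H B (pointMeasure (X ω)) ∂μ := by
  have key : ∀ {Y : Ω → ℕ → ℝ}, IsUnitPoissonProcess μ Y →
      ∫⁻ ω, gapFunctional H B (pointMeasure (Y ω)) ∂μ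
        = ∫⁻ ξ, gapFunctional H B (idKernel ξ) ∂μ.map fun ω => pointMeasure (Y ω) := by
    intro Y hY
    have hm : Measurable fun ω => pointMeasure (Y ω) :=
      measurable_pointMeasure.comp hY.measurable
    rw [lintegral_map (measurable_gapFunctional_idKernel hH hB) hm]
    refine lintegral_congr_ae ?_
    filter_upwards [hY.ae_idKernel] with ω hω
    rw [hω]
  simp_rw [← gapFunctional_sub]
  rw [key (hX.sub_const t), key hX, (hX.sub_const t).map_pointMeasure_unique hX]

variable {H : ℝ → ℝ} {g : Ω → SpatialGraph}

/-- The intensity measure of the point process of uncrossed gaps. -/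
noncomputable def gapIntensity (μ : Measure Ω) (g : Ω → SpatialGraph) : Measure ℝ :=
  Measure.sum fun i => (μ.restrict (gapSet g i)).map fun ω => (g ω).pos i

lemma IsSoftRGG.measurable_pos_apply (hg : IsSoftRGG μ H g) (i : ℕ) :
    Measurable fun ω => (g ω).pos i := (measurable_pi_apply i).comp hg.measurable_pos

lemma IsSoftRGG.gapIntensity_apply (hg : IsSoftRGG μ H g) {B : Set ℝ} (hB : MeasurableSet B) :
    gapIntensity μ g B = ∑' i, μ ({ω | (g ω).pos i ∈ B} ∩ gapSet g i) := by
  rw [gapIntensity, Measure.sum_apply _ hB]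
  refine tsum_congr fun i => ?_
  rw [Measure.map_apply (hg.measurable_pos_apply i) hB,
    Measure.restrict_apply (hg.measurable_pos_apply i hB)]
  rfl

lemma IsSoftRGG.count_gaps_ae_eq (hg : IsSoftRGG μ H g) (B : Set ℝ) :
    ∀ᵐ ω ∂μ, (({x | x ∈ B ∧ (g ω).UncrossedGapAt x}.encard : ℕ∞) : ℝ≥0∞)
      = ∑' i, ({ω | (g ω).pos i ∈ B} ∩ gapSet g i).indicator 1 ω := by
  classical
  filter_upwards [hg.nodes.injective] with ω hω
  have h := tsum_ite_eq_encard hω fun x => x ∈ B ∧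
    ∀ j k : ℕ, (g ω).pos j ≤ x → x < (g ω).pos k → ¬ (g ω).graph.Adj j k
  have h2 : {x | x ∈ B ∧ (g ω).UncrossedGapAt x} = {x | x ∈ Set.range (g ω).pos ∧ x ∈ B ∧
      ∀ j k : ℕ, (g ω).pos j ≤ x → x < (g ω).pos k → ¬ (g ω).graph.Adj j k} := by
    ext x
    exact and_left_comm
  rw [h2, ← h]
  refine tsum_congr fun i => ?_
  rw [Set.indicator_apply]
  rfl

lemma IsSoftRGG.measurable_gap_indicator (hg : IsSoftRGG μ H g) {B : Set ℝ}
    (hB : MeasurableSet B) (i : ℕ) :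
    Measurable (({ω | (g ω).pos i ∈ B} ∩ gapSet g i).indicator (1 : Ω → ℝ≥0∞)) :=
  measurable_one.indicator ((hg.measurable_pos_apply i hB).inter (hg.measurableSet_gapSet i))

lemma IsSoftRGG.aemeasurable_count_gaps (hg : IsSoftRGG μ H g) {B : Set ℝ}
    (hB : MeasurableSet B) :
    AEMeasurable (fun ω => (({x | x ∈ B ∧ (g ω).UncrossedGapAt x}.encard : ℕ∞) : ℝ≥0∞)) μ :=
  ⟨_, Measurable.tsum fun i => hg.measurable_gap_indicator hB i, hg.count_gaps_ae_eq B⟩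

lemma IsSoftRGG.lintegral_count_gaps (hg : IsSoftRGG μ H g) {B : Set ℝ} (hB : MeasurableSet B) :
    ∫⁻ ω, (({x | x ∈ B ∧ (g ω).UncrossedGapAt x}.encard : ℕ∞) : ℝ≥0∞) ∂μ
      = gapIntensity μ g B := by
  rw [lintegral_congr_ae (hg.count_gaps_ae_eq B),
    lintegral_tsum fun i => (hg.measurable_gap_indicator hB i).aemeasurable,
    hg.gapIntensity_apply hB]
  exact tsum_congr fun i => lintegral_indicator_one
    ((hg.measurable_pos_apply i hB).inter (hg.measurableSet_gapSet i))

lemma IsSoftRGG.measurable_crossCost (hg : IsSoftRGG μ H g) (hH : Measurable fun r => H |r|)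
    (i : ℕ) : Measurable fun ω => crossCost H (pointMeasure (g ω).pos) ((g ω).pos i) := by
  simp_rw [crossCost, lintegral_pointMeasure]
  refine Measurable.tsum fun j => Measurable.tsum fun k => ?_
  refine Measurable.ite ?_ ((measurable_edgeCost hH).comp
    ((hg.measurable_pos_apply k).sub (hg.measurable_pos_apply j))) measurable_const
  exact (measurableSet_le (hg.measurable_pos_apply j) (hg.measurable_pos_apply i)).inter
    (measurableSet_lt (hg.measurable_pos_apply i) (hg.measurable_pos_apply k))

theorem IsSoftRGG.gapIntensity_eq_lintegral [IsProbabilityMeasure μ] (hg : IsSoftRGG μ H g)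
    (hH : Measurable fun r => H |r|) (h01 : ∀ r, H |r| ∈ Set.Icc (0 : ℝ) 1) {B : Set ℝ}
    (hB : MeasurableSet B) :
    gapIntensity μ g B = ∫⁻ ω, gapFunctional H B (pointMeasure (g ω).pos) ∂μ := by
  simp_rw [hg.gapIntensity_apply hB, hg.measure_gapSet hH h01 hB, gapFunctional,
    lintegral_pointMeasure]
  refine (lintegral_tsum fun i => Measurable.aemeasurable ?_).symm
  exact ((measurable_one.indicator hB).comp (hg.measurable_pos_apply i)).mul
    (continuous_expNeg.measurable.comp (hg.measurable_crossCost hH i))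

lemma gapFunctional_le (H : ℝ → ℝ) {B : Set ℝ} (hB : MeasurableSet B) (ξ : Measure ℝ) :
    gapFunctional H B ξ ≤ ξ B := by
  rw [← lintegral_indicator_one hB]
  exact lintegral_mono fun y => mul_le_of_le_one_right' (expNeg_le_one _)

lemma IsSoftRGG.gapIntensity_le [IsProbabilityMeasure μ] (hg : IsSoftRGG μ H g)
    (hH : Measurable fun r => H |r|) (h01 : ∀ r, H |r| ∈ Set.Icc (0 : ℝ) 1) {B : Set ℝ}
    (hB : MeasurableSet B) (hv : volume B ≠ ∞) : gapIntensity μ g B ≤ volume B := by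
  rw [hg.gapIntensity_eq_lintegral hH h01 hB, ← hg.nodes.lintegral_count_id hB hv]
  exact lintegral_mono fun ω => gapFunctional_le H hB _

/-- The intensity measure of the uncrossed gaps is a multiple of the Lebesgue measure. -/
theorem IsSoftRGG.gapIntensity_Icc [IsProbabilityMeasure μ] (hg : IsSoftRGG μ H g)
    (hH : Measurable fun r => H |r|) (h01 : ∀ r, H |r| ∈ Set.Icc (0 : ℝ) 1) (L : ℝ) :
    gapIntensity μ g (Set.Icc 0 L) = ENNReal.ofReal L * gapIntensity μ g (Set.Icc 0 1) := by
  have : IsFiniteMeasureOnCompacts (gapIntensity μ g) := ⟨fun K hK =>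
    (hg.gapIntensity_le hH h01 hK.measurableSet hK.measure_lt_top.ne).trans_lt hK.measure_lt_top⟩
  have : (gapIntensity μ g).IsAddLeftInvariant := by
    refine ⟨fun t => Measure.ext fun B hB => ?_⟩
    have hm : Measurable fun y : ℝ => t + y := measurable_const_add t
    rw [Measure.map_apply hm hB, hg.gapIntensity_eq_lintegral hH h01 (hm hB),
      hg.gapIntensity_eq_lintegral hH h01 hB,
      ← hg.nodes.lintegral_gapFunctional_sub hH hB (-t)]
    have : (fun y : ℝ => y - -t) ⁻¹' B = (fun y => t + y) ⁻¹' B := by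
      ext y
      simp [add_comm]
    rw [this]
  -- A translation-invariant measure finite on compacts is a multiple of Lebesgue measure.
  obtain ⟨c, hc⟩ : ∃ c : NNReal, gapIntensity μ g = c • volume :=
    ⟨_, Measure.isAddLeftInvariant_eq_smul (gapIntensity μ g) volume⟩
  simp only [hc, Measure.smul_apply, Real.volume_Icc, sub_zero, ENNReal.ofReal_one, ENNReal.smul_def,
    smul_eq_mul, mul_one]
  exact mul_comm _ _

lemma IsSoftRGG.expectedUncrossedGaps_eq (hg : IsSoftRGG μ H g) (L : ℝ) :
    expectedUncrossedGaps μ g L = gapIntensity μ g (Set.Icc 0 L) :=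
  hg.lintegral_count_gaps measurableSet_Icc

lemma SpatialGraph.uncrossedGapAt_shift (c : SpatialGraph) (x : ℝ) :
    (c.shift x).UncrossedGapAt 0 ↔ c.UncrossedGapAt x := by
  simp [UncrossedGapAt, shift, points, sub_eq_zero]

/-- The denominator is the mean number of nodes in `[0, 1]`, which is one. -/
lemma IsSoftRGG.palmUncrossed_eq [IsProbabilityMeasure μ] (hg : IsSoftRGG μ H g) :
    palmUncrossed μ g = gapIntensity μ g (Set.Icc 0 1) := by
  have h1 : ∫⁻ ω, ((((g ω).points ∩ Set.Icc 0 1).encard : ℕ∞) : ℝ≥0∞) ∂μ = 1 := by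
    refine (lintegral_congr_ae (hg.nodes.count_ae_eq measurableSet_Icc)).trans ?_
    rw [hg.nodes.lintegral_count_id measurableSet_Icc (by simp)]
    simp
  rw [palmUncrossed, palmProb, h1, div_one, ← hg.lintegral_count_gaps measurableSet_Icc]
  refine lintegral_congr fun ω => ?_
  congr 3
  ext x
  change (x ∈ (g ω).points ∩ Set.Icc 0 1 ∧ ((g ω).shift x).UncrossedGapAt 0) ↔ _
  rw [SpatialGraph.uncrossedGapAt_shift]
  constructor
  · exact fun h => ⟨h.1.2, h.2⟩
  · exact fun h => ⟨⟨h.2.1, h.1⟩, h.2⟩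

end Intensity

/-! ### Exponential bound on the gap intensity. -/

/-- Either `h a ≥ 1` and the exponent is at least `b`, or `a < 1/h` and the second term already
exceeds one. This splits the product `a b` so that each window can be averaged alone. -/
lemma expNeg_mul_le {h : ℝ} (hh : 0 < h) (a b : ℝ≥0∞) :
    expNeg (ENNReal.ofReal h * (a * b))
      ≤ expNeg b + ENNReal.ofReal (Real.exp (1 / h)) * expNeg a := by
  rcases le_or_gt 1 (ENNReal.ofReal h * a) with h1 | h1
  · refine le_add_right (expNeg_antitone ?_)
    rw [← mul_assoc]
    exact le_mul_of_one_le_left' h1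
  · have ha : a ≠ ∞ := by
      rintro rfl
      rw [ENNReal.mul_top (by simpa using hh)] at h1
      exact not_top_lt h1
    obtain ⟨t, ht, rfl⟩ : ∃ t : ℝ, 0 ≤ t ∧ a = ENNReal.ofReal t :=
      ⟨a.toReal, ENNReal.toReal_nonneg, (ENNReal.ofReal_toReal ha).symm⟩
    refine le_add_left ((expNeg_le_one _).trans ?_)
    rw [← ENNReal.ofReal_mul hh.le, ENNReal.ofReal_lt_one] at h1
    rw [expNeg_ofReal ht, ← ENNReal.ofReal_mul (Real.exp_nonneg _), ← Real.exp_add,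
      ENNReal.one_le_ofReal, Real.one_le_exp_iff]
    have : t ≤ 1 / h := by
      rw [le_div_iff₀ hh]
      linarith
    linarith

/-- The two windows lie on either side of `[0, 1]`: all their pairs straddle every `y` there, at
distance at most `2l + 1`, and their counts are independent of the count in `[0, 1]`. -/
lemma le_crossCost {H : ℝ → ℝ} (h0 : ∀ r, 0 ≤ H |r|) {h l : ℝ}
    (hl : ∀ r, |r| ≤ 2 * l + 1 → h ≤ H |r|) (ξ : Measure ℝ) {y : ℝ} (hy : y ∈ Set.Icc (0 : ℝ) 1) :
    ENNReal.ofReal h * (ξ (Set.Ico (-l) 0) * ξ (Set.Ioc 1 (1 + l))) ≤ crossCost H ξ y := by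
  have h1 : ENNReal.ofReal h * (ξ (Set.Ico (-l) 0) * ξ (Set.Ioc 1 (1 + l)))
      = ∫⁻ u, (Set.Ico (-l) 0).indicator (fun _ => ∫⁻ v, (Set.Ioc 1 (1 + l)).indicator
          (fun _ => ENNReal.ofReal h) v ∂ξ) u ∂ξ := by
    rw [lintegral_indicator_const measurableSet_Ico, lintegral_indicator_const measurableSet_Ioc]
    ring
  rw [h1]
  refine lintegral_mono fun u => ?_
  by_cases hu : u ∈ Set.Ico (-l) 0
  · rw [Set.indicator_of_mem hu]
    refine lintegral_mono fun v => ?_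
    by_cases hv : v ∈ Set.Ioc 1 (1 + l)
    · rw [Set.indicator_of_mem hv]
      dsimp only
      rw [if_pos ⟨hu.2.le.trans hy.1, hy.2.trans_lt hv.1⟩]
      refine (ENNReal.ofReal_le_ofReal (hl (v - u) ?_)).trans (ofReal_le_edgeCost h0 _)
      rw [abs_of_nonneg (by linarith [hu.2, hv.1])]
      linarith [hu.1, hv.2]
    · rw [Set.indicator_of_notMem hv]
      exact zero_le
  · rw [Set.indicator_of_notMem hu]
    exact zero_le

lemma gapFunctional_unit_le {H : ℝ → ℝ} (h0 : ∀ r, 0 ≤ H |r|) {h l : ℝ} (hh : 0 < h)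
    (hl : ∀ r, |r| ≤ 2 * l + 1 → h ≤ H |r|) (ξ : Measure ℝ) :
    gapFunctional H (Set.Icc 0 1) ξ
      ≤ ξ (Set.Icc 0 1) * expNeg (ξ (Set.Ioc 1 (1 + l)))
        + ENNReal.ofReal (Real.exp (1 / h)) *
          (ξ (Set.Icc 0 1) * expNeg (ξ (Set.Ico (-l) 0))) := by
  calc gapFunctional H (Set.Icc 0 1) ξ
      ≤ ∫⁻ y, (Set.Icc (0 : ℝ) 1).indicator (fun _ => expNeg (ξ (Set.Ioc 1 (1 + l)))
        + ENNReal.ofReal (Real.exp (1 / h)) * expNeg (ξ (Set.Ico (-l) 0))) y ∂ξ := by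
        refine lintegral_mono fun y => ?_
        by_cases hy : y ∈ Set.Icc (0 : ℝ) 1
        · rw [Set.indicator_of_mem hy, Set.indicator_of_mem hy, Pi.one_apply, one_mul]
          exact (expNeg_antitone (le_crossCost h0 hl ξ hy)).trans (expNeg_mul_le hh _ _)
        · rw [Set.indicator_of_notMem hy, Set.indicator_of_notMem hy, zero_mul]
    _ = _ := by
      rw [lintegral_indicator_const measurableSet_Icc]
      ring

section

variable {Ω : Type*} [MeasurableSpace Ω] {μ : Measure Ω} [IsProbabilityMeasure μ]

lemma IsUnitPoissonProcess.lintegral_expNeg_count {X : Ω → ℕ → ℝ}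
    (hX : IsUnitPoissonProcess μ X) {B : Set ℝ} (hB : MeasurableSet B) {l : ℝ} (hl : 0 ≤ l)
    (hv : volume B = ENNReal.ofReal l) :
    ∫⁻ ω, expNeg (pointMeasure (X ω) B) ∂μ
      = ENNReal.ofReal (Real.exp (-(l * (1 - Real.exp (-1))))) := by
  rw [hX.lintegral_count hB (by simp [hv]) continuous_expNeg.measurable]
  have h : ∀ n : ℕ, expNeg n = ENNReal.ofReal (Real.exp (-(n : ℕ))) := by
    intro n
    rw [← ENNReal.ofReal_natCast, expNeg_ofReal n.cast_nonneg]
  simp_rw [h]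
  rw [lintegral_exp_neg_poissonMeasure, hv, ENNReal.coe_toNNReal_eq_toReal,
    ENNReal.toReal_ofReal hl]

lemma IsUnitPoissonProcess.lintegral_count_mul_expNeg {X : Ω → ℕ → ℝ}
    (hX : IsUnitPoissonProcess μ X) {A B : Set ℝ} (hA : MeasurableSet A) (hB : MeasurableSet B)
    (hAB : Disjoint A B) (hvA : volume A = 1) {l : ℝ} (hl : 0 ≤ l)
    (hv : volume B = ENNReal.ofReal l) :
    ∫⁻ ω, pointMeasure (X ω) A * expNeg (pointMeasure (X ω) B) ∂μ
      = ENNReal.ofReal (Real.exp (-(l * (1 - Real.exp (-1))))) := by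
  have hi := hX.iIndepFun_count (fun b : Bool => if b then A else B)
    (by simp [hA, hB]) (by
      rintro (_ | _) (_ | _) hb
      · exact absurd rfl hb
      · simpa using hAB.symm
      · simpa using hAB
      · exact absurd rfl hb)
  have hi2 : IndepFun (fun ω => pointMeasure (X ω) A) (fun ω => pointMeasure (X ω) B) μ := by
    simpa using hi.indepFun (i := true) (j := false) (by simp)
  have hi3 : IndepFun (fun ω => pointMeasure (X ω) A)
      (fun ω => expNeg (pointMeasure (X ω) B)) μ :=
    hi2.comp measurable_id continuous_expNeg.measurable
  have h := lintegral_mul_eq_lintegral_mul_lintegral_of_indepFun (hX.measurable_count hA)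
    (continuous_expNeg.measurable.comp (hX.measurable_count hB)) hi3
  refine h.trans ?_
  rw [hX.lintegral_count_id hA (by simp [hvA]), hvA, one_mul]
  exact hX.lintegral_expNeg_count hB hl hv

/-- A quantitative bound on the intensity of uncrossed gaps. -/
theorem IsSoftRGG.gapIntensity_unit_le {H : ℝ → ℝ} {g : Ω → SpatialGraph}
    (hg : IsSoftRGG μ H g) (hH : Measurable fun r => H |r|)
    (h01 : ∀ r, H |r| ∈ Set.Icc (0 : ℝ) 1) {h l : ℝ} (hh : 0 < h) (hl0 : 0 ≤ l)
    (hl : ∀ r, |r| ≤ 2 * l + 1 → h ≤ H |r|) :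
    gapIntensity μ g (Set.Icc 0 1)
      ≤ ENNReal.ofReal ((1 + Real.exp (1 / h)) * Real.exp (-(l * (1 - Real.exp (-1))))) := by
  rw [hg.gapIntensity_eq_lintegral hH h01 measurableSet_Icc]
  refine (lintegral_mono fun ω => gapFunctional_unit_le (fun r => (h01 r).1) hh hl _).trans ?_
  have hmeas : ∀ B : Set ℝ, MeasurableSet B → Measurable fun ω =>
      pointMeasure (g ω).pos (Set.Icc 0 1) * expNeg (pointMeasure (g ω).pos B) := fun B hB =>
    (hg.nodes.measurable_count measurableSet_Icc).mul
      (continuous_expNeg.measurable.comp (hg.nodes.measurable_count hB))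
  rw [lintegral_add_left (hmeas _ measurableSet_Ioc),
    lintegral_const_mul _ (hmeas _ measurableSet_Ico),
    hg.nodes.lintegral_count_mul_expNeg measurableSet_Icc measurableSet_Ioc
      (Set.disjoint_left.2 fun x hx hx' => (hx.2.trans_lt hx'.1).false) (by simp) hl0 (by simp),
    hg.nodes.lintegral_count_mul_expNeg measurableSet_Icc measurableSet_Ico
      (Set.disjoint_left.2 fun x hx hx' => (hx.1.trans_lt hx'.2).false) (by simp) hl0 (by simp),
    ← ENNReal.ofReal_mul (Real.exp_nonneg _), ← ENNReal.ofReal_add (by positivity) (by positivity)]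
  exact ENNReal.ofReal_le_ofReal (by linarith)

/-- Markov's inequality for the number of gaps at level one. -/
lemma IsSoftRGG.measure_exists_gap_le {Ω : Type*} [MeasurableSpace Ω] {μ : Measure Ω} {H : ℝ → ℝ} {g : Ω → SpatialGraph}
    (hg : IsSoftRGG μ H g) (L : ℝ) :
    μ {ω | ∃ x ∈ Set.Icc (0 : ℝ) L, (g ω).UncrossedGapAt x} ≤ expectedUncrossedGaps μ g L := by
  have h := mul_meas_ge_le_lintegral₀
    (hg.aemeasurable_count_gaps (B := Set.Icc 0 L) measurableSet_Icc) 1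
  rw [one_mul] at h
  refine (measure_mono ?_).trans h
  rintro ω ⟨x, hx, hgap⟩
  have : (1 : ℕ∞) ≤ {x | x ∈ Set.Icc 0 L ∧ (g ω).UncrossedGapAt x}.encard :=
    Set.one_le_encard_iff_nonempty.2 ⟨x, hx, hgap⟩
  change (1 : ℝ≥0∞) ≤ _
  exact_mod_cast this

end

/-! ### Inserting the range `R_L = γ log L`. -/

section Scaling

variable {H : ℝ → ℝ}

lemma measurable_scaled (hHanti : AntitoneOn H (Set.Ici 0)) {R : ℝ} (hR : 0 < R) :
    Measurable fun r : ℝ => H (|r| / R) := by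
  -- `H` is monotone only on `[0, ∞)`, so it is extended by a constant to the left.
  have h1 : Antitone fun s : ℝ => H (max s 0) := fun s t hst =>
    hHanti (Set.mem_Ici.2 (le_max_right _ _)) (Set.mem_Ici.2 (le_max_right _ _))
      (max_le_max_right 0 hst)
  have h2 : Measurable fun r : ℝ => |r| / R := by fun_prop
  have h3 : (fun r : ℝ => H (|r| / R)) = (fun s : ℝ => H (max s 0)) ∘ fun r : ℝ => |r| / R := by
    ext r
    have : 0 ≤ |r| / R := by positivity
    simp [this]
  rw [h3]
  exact h1.measurable.comp h2

lemma pos_of_unbounded_support (hHanti : AntitoneOn H (Set.Ici 0))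
    (hHsupp : ∀ r, 0 ≤ r → 0 < ∫⁻ x in Set.Ioi r, ENNReal.ofReal (H x)) {r : ℝ} (hr : 0 ≤ r) :
    0 < H r := by
  by_contra! hcon
  refine (hHsupp r hr).ne' ?_
  rw [setLIntegral_congr_fun (g := fun _ => 0) measurableSet_Ioi]
  · simp
  · intro x hx
    exact ENNReal.ofReal_of_nonpos ((hHanti hr (hr.trans (le_of_lt hx)) (le_of_lt hx)).trans hcon)

/-- Under the Palm measure, the origin marks an uncrossed gap with probability `O(L ^ (-κ))`. -/
theorem palmUncrossed_decay (hH01 : ∀ r, 0 ≤ r → H r ∈ Set.Icc (0 : ℝ) 1)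
    (hHanti : AntitoneOn H (Set.Ici 0))
    (hHsupp : ∀ r, 0 ≤ r → 0 < ∫⁻ x in Set.Ioi r, ENNReal.ofReal (H x))
    {γ : ℝ} (hγ : 0 < γ) {Ω : ℝ → Type*} [∀ L, MeasurableSpace (Ω L)]
    {μ : ∀ L, Measure (Ω L)} [∀ L, IsProbabilityMeasure (μ L)]
    {g : ∀ L, Ω L → SpatialGraph}
    (hg : ∀ L, 1 < L → IsSoftRGG (μ L) (fun r => H (r / (γ * Real.log L))) (g L))
    {κ : ℝ} (hκ : 0 < κ) :
    ∃ C : ℝ, 0 ≤ C ∧ ∀ᶠ L in atTop, palmUncrossed (μ L) (g L) ≤ ENNReal.ofReal (C * L ^ (-κ)) := by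
  -- With this `K` the window length is `K R = 2 κ log L`; the factor 2 makes up for `1 - 1/e ≥ 1/2`
  -- below.
  set K : ℝ := 2 * κ / γ with hK
  have hK0 : 0 < K := by positivity
  have hh : 0 < H (2 * K + 1) := pos_of_unbounded_support hHanti hHsupp (by positivity)
  refine ⟨1 + Real.exp (1 / H (2 * K + 1)), by positivity, ?_⟩
  -- Once `R ≥ 1`, the largest distance `2KR + 1` is at most `(2K + 1) R`, so `h = H (2K + 1)` does
  -- not depend on `L`.
  have hev : ∀ᶠ L in atTop, 1 ≤ γ * Real.log L :=
    (Real.tendsto_log_atTop.const_mul_atTop hγ).eventually_ge_atTop 1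
  filter_upwards [hev, eventually_gt_atTop 1] with L hR hL
  set R := γ * Real.log L with hRdef
  have hR0 : 0 < R := by linarith
  rw [(hg L hL).palmUncrossed_eq]
  refine ((hg L hL).gapIntensity_unit_le (measurable_scaled hHanti hR0)
    (fun r => hH01 _ (by positivity)) hh (l := K * R) (by positivity) ?_).trans ?_
  · intro r hr
    have h1 : |r| / R ≤ 2 * K + 1 := by
      rw [div_le_iff₀ hR0]
      linarith
    exact hHanti (Set.mem_Ici.2 (by positivity)) (Set.mem_Ici.2 (by positivity)) h1
  · refine ENNReal.ofReal_le_ofReal (mul_le_mul_of_nonneg_left ?_ (by positivity))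
    rw [Real.rpow_def_of_pos (by linarith), Real.exp_le_exp]
    have h2 : K * R = 2 * κ * Real.log L := by
      rw [hK, hRdef]
      field_simp
    have h3 : Real.exp (-1) ≤ 1 / 2 := by
      rw [Real.exp_neg, one_div]
      exact inv_anti₀ (by norm_num) (by linarith [Real.add_one_le_exp (1 : ℝ)])
    have h4 : 0 ≤ κ * Real.log L := mul_nonneg hκ.le (Real.log_nonneg hL.le)
    rw [h2]
    nlinarith [mul_le_mul_of_nonneg_left h3 h4]

end Scaling

end SoftRGG

/-! ### Assembly of the four claims. -/

theorem mainTheorem3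
    (H : ℝ → ℝ)
    (hH01 : ∀ r, 0 ≤ r → H r ∈ Set.Icc (0 : ℝ) 1)
    (hHanti : AntitoneOn H (Set.Ici 0))
    (hHsupp : ∀ r, 0 ≤ r → 0 < ∫⁻ x in Set.Ioi r, ENNReal.ofReal (H x))
    (γ : ℝ) (hγ : 0 < γ)
    {Ω : ℝ → Type*} [∀ L, MeasurableSpace (Ω L)]
    (μ : ∀ L, Measure (Ω L)) [∀ L, IsProbabilityMeasure (μ L)]
    (g : ∀ L, Ω L → SoftRGG.SpatialGraph)
    (hg : ∀ L, 1 < L →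
      SoftRGG.IsSoftRGG (μ L) (fun r => H (r / (γ * Real.log L))) (g L)) :
    -- the expected number of gaps is `L` times the Palm probability
    (∀ L, 1 < L → SoftRGG.expectedUncrossedGaps (μ L) (g L) L
        = ENNReal.ofReal L * SoftRGG.palmUncrossed (μ L) (g L)) ∧
    -- a typical point marks an uncrossed gap with probability `O(L ^ (-κ))`, for every `κ > 0`
    (∀ κ : ℝ, 0 < κ → ∃ C : ℝ, ∀ᶠ L in atTop,
      SoftRGG.palmUncrossed (μ L) (g L) ≤ ENNReal.ofReal (C * L ^ (-κ))) ∧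
    -- the expected number of gaps is at most `L ^ (1 - κ) * (1 + o(1))`, for every `κ > 0`
    (∀ κ : ℝ, 0 < κ → ∃ ε : ℝ → ℝ, Tendsto ε atTop (𝓝 0) ∧ ∀ L, 1 < L →
      SoftRGG.expectedUncrossedGaps (μ L) (g L) L
        ≤ ENNReal.ofReal (L ^ (1 - κ) * (1 + ε L))) ∧
    -- the expected number of gaps, and the probability that there is one, tend to zero
    Tendsto (fun L => SoftRGG.expectedUncrossedGaps (μ L) (g L) L) atTop (𝓝 0) ∧
    Tendsto (fun L => μ L {ω | ∃ x ∈ Set.Icc (0 : ℝ) L, (g L ω).UncrossedGapAt x})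
      atTop (𝓝 0) := by
  have hR : ∀ L : ℝ, 1 < L → 0 < γ * Real.log L := fun L hL => mul_pos hγ (Real.log_pos hL)
  have hmeas : ∀ L : ℝ, 1 < L → Measurable fun r : ℝ => H (|r| / (γ * Real.log L)) :=
    fun L hL => SoftRGG.measurable_scaled hHanti (hR L hL)
  have hbd : ∀ L : ℝ, 1 < L → ∀ r : ℝ, H (|r| / (γ * Real.log L)) ∈ Set.Icc (0 : ℝ) 1 :=
    fun L hL r => hH01 _ (div_nonneg (abs_nonneg r) (hR L hL).le)
  have part1 : ∀ L, 1 < L → SoftRGG.expectedUncrossedGaps (μ L) (g L) L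
      = ENNReal.ofReal L * SoftRGG.palmUncrossed (μ L) (g L) := by
    intro L hL
    rw [(hg L hL).expectedUncrossedGaps_eq, (hg L hL).palmUncrossed_eq,
      (hg L hL).gapIntensity_Icc (hmeas L hL) (hbd L hL)]
  have hfin : ∀ L, 1 < L → SoftRGG.expectedUncrossedGaps (μ L) (g L) L ≠ ∞ := by
    intro L hL
    rw [(hg L hL).expectedUncrossedGaps_eq]
    exact ne_top_of_le_ne_top (by simp)
      ((hg L hL).gapIntensity_le (hmeas L hL) (hbd L hL) measurableSet_Icc (by simp))
  have decay : ∀ κ : ℝ, 0 < κ → ∃ C : ℝ, 0 ≤ C ∧ ∀ᶠ L in atTop,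
      SoftRGG.expectedUncrossedGaps (μ L) (g L) L ≤ ENNReal.ofReal (C * L ^ (-κ)) := by
    intro κ hκ
    -- The exponent `κ + 1` absorbs the factor `L` from the first claim.
    obtain ⟨C, hC, h⟩ := SoftRGG.palmUncrossed_decay hH01 hHanti hHsupp hγ hg
      (κ := κ + 1) (by linarith)
    refine ⟨C, hC, ?_⟩
    filter_upwards [h, eventually_gt_atTop 1] with L h hL
    have hL0 : 0 < L := by linarith
    rw [part1 L hL]
    refine (mul_le_mul_right h _).trans (le_of_eq ?_)
    rw [← ENNReal.ofReal_mul hL0.le]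
    congr 1
    rw [neg_add, Real.rpow_add hL0, Real.rpow_neg_one]
    field_simp
  have part4 : Tendsto (fun L => SoftRGG.expectedUncrossedGaps (μ L) (g L) L) atTop (𝓝 0) := by
    obtain ⟨C, -, h⟩ := decay 1 one_pos
    refine tendsto_of_tendsto_of_tendsto_of_le_of_le' tendsto_const_nhds ?_
      (Eventually.of_forall fun _ => zero_le) h
    have h1 := ENNReal.tendsto_ofReal ((tendsto_rpow_neg_atTop one_pos).const_mul C)
    simpa using h1
  refine ⟨part1, fun κ hκ => ?_, fun κ hκ => ?_, part4, ?_⟩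
  · obtain ⟨C, -, h⟩ := SoftRGG.palmUncrossed_decay hH01 hHanti hHsupp hγ hg hκ
    exact ⟨C, h⟩
  -- The error is the ratio itself, so the bound is immediate for every `L > 1`. It is at most `C /
  -- L` for large `L`, because the expectation is `O(L ^ (-κ))`.
  · refine ⟨fun L => (SoftRGG.expectedUncrossedGaps (μ L) (g L) L).toReal / L ^ (1 - κ), ?_, ?_⟩
    · obtain ⟨C, hC, h⟩ := decay κ hκ
      have h1 : Tendsto (fun L : ℝ => C * L ^ (-(1 : ℝ))) atTop (𝓝 0) := by
        simpa using (tendsto_rpow_neg_atTop one_pos).const_mul C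
      refine tendsto_of_tendsto_of_tendsto_of_le_of_le' tendsto_const_nhds h1 ?_ ?_
      · filter_upwards [eventually_gt_atTop 0] with L hL
        positivity
      · filter_upwards [h, eventually_gt_atTop 0] with L h hL
        rw [div_le_iff₀ (by positivity), mul_assoc, ← Real.rpow_add hL]
        refine (ENNReal.toReal_le_of_le_ofReal (by positivity) h).trans (le_of_eq ?_)
        ring_nf
    · intro L hL
      have hL0 : 0 < L := by linarith
      rw [← ENNReal.ofReal_toReal (hfin L hL)]
      refine ENNReal.ofReal_le_ofReal ?_
      have h1 : 0 < L ^ (1 - κ) := by positivity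
      dsimp only
      rw [mul_add, mul_div_cancel₀ _ h1.ne']
      linarith
  · refine tendsto_of_tendsto_of_tendsto_of_le_of_le' tendsto_const_nhds part4
      (Eventually.of_forall fun _ => zero_le) ?_
    filter_upwards [eventually_gt_atTop 1] with L hL
    exact (hg L hL).measure_exists_gap_le L
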